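/- Let $n\ge 3$ be an odd integer and $k\ge 2$ an integer. Blocks have width $1$, length $n$ and an arbitrary fixed height $h>0$; they are stacked in horizontal levels, each level having $n$ parallel boxes side by side (so that a full level is an $n\times n$ slab), and the direction of the blocks is rotated by a right angle from each level to the next. There is exactly one pair $(x,l)$ of integers with $$x\ge 3,\qquad nk=n+\frac{n-1}{2}+\frac{n+1}{2}(x-3)+l,\qquad 1\le l\le \frac{n+1}{2}.$$ An $(n,k)$-configuration is an arrangement of blocks in $x$ levels such that: the top level consists of $\frac{n-1}{2}$ blocks in consecutive boxes; the second level from the top is full ($n$ blocks); the bottom level consists of $l$ blocks, no two of them in adjacent boxes; and each of the remaining $x-3$ middle levels consists of the $\frac{n+1}{2}$ blocks in the boxes number $1,3,5,\dots,n$. A polyhedral closed surface in $\mathbb R^3$ is a union of finitely many convex polygons, any two of which are disjoint or meet exactly in a common vertex or exactly in a common edge, such that every edge belongs to exactly two polygons and the link of every vertex $v$ (the union of those edges of the polygons at $v$ that do not contain $v$) is connected. The genus $g$ of a connected polyhedral closed surface with $V$ vertices, $E$ edges and $F$ faces is given by $V-E+F=2-2g$. **Theorem.** An $(n,k)$-configuration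 exists, and for every $(n,k)$-configuration the boundary $Q(n,k)$ of the union of its blocks is a connected polyhedral closed surface of genus $$g(n,k)=\frac{n(n-1)(k-2)}{2}.$$ -/

import Mathlib

namespace Jenga

/-- The ambient space `ℝ³`. Only its topology and its affine structure are used below. -/
abbrev Space : Type := Fin 3 → ℝ

/-! ### Polyhedra and polyhedral closed surfaces -/

/-- A convex polygon in `ℝ³`: the convex hull of finitely many points, of dimension two. -/
def IsConvexPolygon (f : Set Space) : Prop :=
  (∃ s : Finset Space, f = convexHull ℝ (s : Set Space)) ∧
    Module.finrank ℝ (vectorSpan ℝ f) = 2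

/-- The vertices of a convex polygon (or the end points of a segment): its extreme points. -/
def cellVertices (f : Set Space) : Set Space := Set.extremePoints ℝ f

/-- The edges of a convex polygon: the nondegenerate segments that are faces of it. -/
def polygonEdges (f : Set Space) : Set (Set Space) :=
  {e | ∃ a b : Space, a ≠ b ∧ e = segment ℝ a b ∧ IsExtreme ℝ f e}

/-- A (two-dimensional) polyhedron in `ℝ³`: finitely many convex polygons, glued along vertices or
along edges, that is, any two of them are disjoint or meet exactly in a common vertex or exactly in
a common edge. -/
structure Polyhedron where
  faces : Set (Set Space)
  finite_faces : faces.Finite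
  isConvexPolygon : ∀ f ∈ faces, IsConvexPolygon f
  glued : ∀ f ∈ faces, ∀ g ∈ faces, f ≠ g →
    f ∩ g = ∅ ∨
    (∃ v, v ∈ cellVertices f ∧ v ∈ cellVertices g ∧ f ∩ g = {v}) ∨
    (∃ e, e ∈ polygonEdges f ∧ e ∈ polygonEdges g ∧ f ∩ g = e)

namespace Polyhedron

/-- The underlying subset of `ℝ³`. -/
def support (P : Polyhedron) : Set Space := ⋃₀ P.faces

/-- The set of all vertices. -/
def vertices (P : Polyhedron) : Set Space := {v | ∃ f ∈ P.faces, v ∈ cellVertices f}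

/-- The set of all edges. -/
def edges (P : Polyhedron) : Set (Set Space) := {e | ∃ f ∈ P.faces, e ∈ polygonEdges f}

/-- The link of `v`: the edges that lie on a face having `v` as a vertex, and that do not have `v`
as an end point. -/
def link (P : Polyhedron) (v : Space) : Set (Set Space) :=
  {e | ∃ f ∈ P.faces, e ∈ polygonEdges f ∧ v ∈ cellVertices f ∧ v ∉ cellVertices e}

/-- A polyhedral closed surface: every edge is an edge of exactly two faces, and the link of every
vertex is connected (as a subset of `ℝ³`). -/
def IsClosedSurface (P : Polyhedron) : Prop :=
  (∀ e ∈ P.edges, {f | f ∈ P.faces ∧ e ∈ polygonEdges f}.ncard = 2) ∧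
    ∀ v ∈ P.vertices, IsConnected (⋃₀ P.link v)

/-- The Euler characteristic `#V - #E + #F`. -/
noncomputable def eulerChar (P : Polyhedron) : ℤ :=
  (P.vertices.ncard : ℤ) - (P.edges.ncard : ℤ) + (P.faces.ncard : ℤ)

end Polyhedron

/-- The subset `Q` of `ℝ³` is a (connected) polyhedral closed surface of genus `g`. A closed surface
in `ℝ³` is orientable, so its genus is given by `#V - #E + #F = 2 - 2g`. -/
def IsPolyhedralClosedSurfaceOfGenus (Q : Set Space) (g : ℕ) : Prop :=
  ∃ P : Polyhedron, P.support = Q ∧ P.IsClosedSurface ∧ IsConnected Q ∧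
    P.eulerChar = 2 - 2 * (g : ℤ)

/-! ### Configurations of blocks -/

/-- A configuration with `x` levels of `n` boxes each (its box description): `C i` is the set of the
boxes of level `i` that hold a block. Levels are numbered `0, …, x - 1` from the bottom to the top,
boxes `0, …, n - 1` from the left to the right. -/
abbrev Configuration (n x : ℕ) : Type := Fin x → Finset (Fin n)

/-- The block in box `j` of level `i`: it has width `1`, length `n` and height `h`, and its
direction is rotated by a right angle from each level to the next. -/
def block (n : ℕ) (h : ℝ) (i j : ℕ) : Set Space :=
  if Even i then
    {p | p 0 ∈ Set.Icc (0 : ℝ) n ∧ p 1 ∈ Set.Icc (j : ℝ) (j + 1) ∧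
      p 2 ∈ Set.Icc (h * i) (h * (i + 1))}
  else
    {p | p 0 ∈ Set.Icc (j : ℝ) (j + 1) ∧ p 1 ∈ Set.Icc (0 : ℝ) n ∧
      p 2 ∈ Set.Icc (h * i) (h * (i + 1))}

/-- The union of the blocks of a configuration. -/
def solid {n x : ℕ} (h : ℝ) (C : Configuration n x) : Set Space :=
  ⋃ i : Fin x, ⋃ j ∈ C i, block n h i j

/-- The surface of a configuration: the boundary of the union of its blocks. -/
def surface {n x : ℕ} (h : ℝ) (C : Configuration n x) : Set Space := frontier (solid h C)

/-- The conditions that determine the number `x` of levels and the number `l` of blocks of the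
bottom level of the `(n, k)`-configuration for odd `n`. -/
def LevelData (n k x l : ℕ) : Prop :=
  3 ≤ x ∧ n * k = n + (n - 1) / 2 + (n + 1) / 2 * (x - 3) + l ∧ 1 ≤ l ∧ l ≤ (n + 1) / 2

/-- `C` is an `(n, k)`-configuration, for odd `n`, with `x` levels and `l` blocks at the bottom. -/
structure IsOddConfiguration (n k x l : ℕ) (C : Configuration n x) : Prop where
  levelData : LevelData n k x l
  /-- The top level consists of `(n - 1) / 2` blocks without gaps. -/
  top : ∀ i : Fin x, (i : ℕ) + 1 = x → ∃ a : ℕ, a + (n - 1) / 2 ≤ n ∧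
    ∀ j : Fin n, j ∈ C i ↔ a ≤ (j : ℕ) ∧ (j : ℕ) < a + (n - 1) / 2
  /-- The second level from the top is full. -/
  second : ∀ i : Fin x, (i : ℕ) + 2 = x → C i = Finset.univ
  /-- Each of the `x - 3` middle levels consists of the `(n + 1) / 2` blocks in every other box,
  starting with the leftmost box and ending with the rightmost one. -/
  middle : ∀ i : Fin x, 1 ≤ (i : ℕ) → (i : ℕ) + 3 ≤ x →
    ∀ j : Fin n, j ∈ C i ↔ Even (j : ℕ)
  /-- The bottom level has `l` blocks, no two of them in adjacent boxes. -/
  bottom : ∀ i : Fin x, (i : ℕ) = 0 → (C i).card = l ∧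
    ∀ j ∈ C i, ∀ j' ∈ C i, (j : ℕ) + 1 ≠ (j' : ℕ)

end Jenga

/-! Cut every block into unit cubes of the grid with mesh `(1, 1, h)`. The boundary of the solid is
then the union of the grid squares that separate a filled cube from an empty one, and these squares
are the faces of the polyhedron. Writing cells in doubled integer coordinates turns incidence,
vertices, edges and intersections into integer inequalities (`mem_cellSet`, `polygonEdges_cellSet`,
`frontier_iUnion_cube`).

Closed surface: this is a local condition at each grid vertex, where only the eight surrounding
cubes matter. Blocks in one level are parallel, consecutive levels are perpendicular, and every
block stays over the `n × n` square; nine Booleans describe all patterns that can occur, and a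
finite check shows that every edge lies on zero or two boundary squares and that the squares at a
vertex are connected through edges (`card_mixed_pattern`, `linkStep_pattern`).

Connectedness: call the side plane of a run of blocks a wall. Walls of consecutive levels cross, and
every other boundary square can be slid along a run to a wall (`linked_of_isBoundary`).

Euler characteristic: it is the sum of the signs `(-1) ^ dim` over the boundary cells. At a fixed
height, the indicator of the boundary is a combination of products of one-dimensional indicators, so
the sum factors. If level `i` has `r i` maximal runs of adjacent blocks, the cells inside a level
contribute 0 and the interface of levels `i` and `i + 1` contributes `r i + r (i + 1) - 2 * r i * r
(i + 1)` (`altSum_layer`, `altSum_interface`).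

Put `n = 2 * q + 1`. The runs from bottom to top are `l`, then `x - 3` times `q + 1`, then 1 and 1.
For `x > 3` the sum is `2 - 2 * q * (l + (q + 1) * (x - 4))`, and the block count says that the
bracket is `n * (k - 2)`. For `x = 3` the count forces `k = 2`, and the sum is 2. -/

namespace Jenga

/-! ### Cells of the cubical grid -/

/-- A cell of the cubical grid of `ℝ³`, in doubled coordinates: an even coordinate `2 * i` stands for
the point `i`, an odd coordinate `2 * i + 1` for the interval `[i, i + 1]`. -/
abbrev Cell : Type := Fin 3 → ℤ

/-- The cell `z` is a face of the cell `w`. -/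
def IsFace (z w : Cell) : Prop := ∀ d, w d / 2 ≤ z d / 2 ∧ (z d + 1) / 2 ≤ (w d + 1) / 2

/-- The dimension of a cell. -/
def dim (z : Cell) : ℤ := ∑ d, z d % 2

/-- The subset of `ℝ³` described by a cell, for the grid with mesh `c d` in direction `d`. -/
def cellSet (c : Space) (z : Cell) : Set Space :=
  Set.univ.pi fun d => Set.Icc (c d * (z d / 2 : ℤ)) (c d * ((z d + 1) / 2 : ℤ))

/-- The center of a cell. -/
noncomputable def center (c : Space) (z : Cell) : Space := fun d => c d * (z d / 2 : ℝ)

/-- The cell that contains a given point in its relative interior. -/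
noncomputable def carrier (c : Space) (p : Space) : Cell := fun d => ⌊p d / c d⌋ + ⌈p d / c d⌉

theorem dim_eq (z : Cell) : dim z = z 0 % 2 + z 1 % 2 + z 2 % 2 := by
  simp [dim, Fin.sum_univ_three]

theorem dim_eq_zero_iff (z : Cell) : dim z = 0 ↔ ∀ d, z d % 2 = 0 := by
  rw [dim_eq, Fin.forall_fin_succ, Fin.forall_fin_two]
  simp only [Fin.succ_zero_eq_one, Fin.succ_one_eq_two]
  omega

theorem isFace_iff (z w : Cell) : IsFace z w ↔
    (w 0 / 2 ≤ z 0 / 2 ∧ (z 0 + 1) / 2 ≤ (w 0 + 1) / 2) ∧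
    (w 1 / 2 ≤ z 1 / 2 ∧ (z 1 + 1) / 2 ≤ (w 1 + 1) / 2) ∧
    (w 2 / 2 ≤ z 2 / 2 ∧ (z 2 + 1) / 2 ≤ (w 2 + 1) / 2) := by
  rw [IsFace, Fin.forall_fin_succ, Fin.forall_fin_two]
  rfl

theorem IsFace.refl (z : Cell) : IsFace z z := fun _ => ⟨le_rfl, le_rfl⟩

theorem IsFace.trans {x y z : Cell} (h : IsFace x y) (h' : IsFace y z) : IsFace x z :=
  fun d => ⟨(h' d).1.trans (h d).1, (h d).2.trans (h' d).2⟩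

theorem IsFace.antisymm {y z : Cell} (h : IsFace y z) (h' : IsFace z y) : y = z := by
  funext d
  have := h d
  have := h' d
  omega

theorem IsFace.eq_of_dim_le {y z : Cell} (h : IsFace y z) (hd : dim z ≤ dim y) : y = z := by
  rw [dim_eq, dim_eq] at hd
  have h' := (isFace_iff _ _).1 h
  refine h.antisymm ((isFace_iff _ _).2 ?_)
  omega

theorem carrier_center {c : Space} (hc : ∀ d, 0 < c d) (z : Cell) : carrier c (center c z) = z := by
  funext d
  have h : center c z d / c d = (z d / 2 : ℝ) := by
    rw [center, mul_div_cancel_left₀ _ (hc d).ne']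
  rw [carrier, h]
  have h2 : (z d : ℝ) = 2 * (z d / 2 : ℤ) + (z d % 2 : ℤ) := by
    exact_mod_cast (Int.mul_ediv_add_emod (z d) 2).symm
  have hfl : ⌊(z d / 2 : ℝ)⌋ = z d / 2 := by
    rw [Int.floor_eq_iff, h2]
    rcases Int.emod_two_eq_zero_or_one (z d) with h | h <;> rw [h] <;> push_cast <;>
      constructor <;> linarith
  have hce : ⌈(z d / 2 : ℝ)⌉ = (z d + 1) / 2 := by
    rcases Int.emod_two_eq_zero_or_one (z d) with h | h
    · rw [show (z d + 1) / 2 = z d / 2 by omega, Int.ceil_eq_iff, h2, h]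
      push_cast
      constructor <;> linarith
    · rw [show (z d + 1) / 2 = z d / 2 + 1 by omega, Int.ceil_eq_iff, h2, h]
      push_cast
      constructor <;> linarith
  rw [hfl, hce]
  omega

theorem center_injective {c : Space} (hc : ∀ d, 0 < c d) : Function.Injective (center c) :=
  Function.LeftInverse.injective (carrier_center hc)

/-- Halving the carrier downwards and upwards recovers the floor and the ceiling of `p d / c d`.
From here on, statements about boxes become statements about `IsFace`, which `omega` can decide. -/
theorem mem_cellSet {c : Space} (hc : ∀ d, 0 < c d) {p : Space} {w : Cell} :
    p ∈ cellSet c w ↔ IsFace (carrier c p) w := by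
  simp only [cellSet, Set.mem_univ_pi, Set.mem_Icc, IsFace]
  refine forall_congr' fun d => ?_
  have h1 := Int.floor_le_ceil (p d / c d)
  have h2 := Int.ceil_le_floor_add_one (p d / c d)
  have e1 : carrier c p d / 2 = ⌊p d / c d⌋ := by
    simp only [carrier]; omega
  have e2 : (carrier c p d + 1) / 2 = ⌈p d / c d⌉ := by
    simp only [carrier]; omega
  rw [e1, e2, Int.le_floor, Int.ceil_le, le_div_iff₀ (hc d), div_le_iff₀ (hc d), mul_comm (c d),
    mul_comm (c d)]

theorem center_mem_cellSet {c : Space} (hc : ∀ d, 0 < c d) {z w : Cell} :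
    center c z ∈ cellSet c w ↔ IsFace z w := by
  rw [mem_cellSet hc, carrier_center hc]

theorem cellSet_subset_iff {c : Space} (hc : ∀ d, 0 < c d) {z w : Cell} :
    cellSet c z ⊆ cellSet c w ↔ IsFace z w := by
  constructor
  · intro h
    exact (center_mem_cellSet hc).1 (h ((center_mem_cellSet hc).2 (IsFace.refl z)))
  · intro h p hp
    rw [mem_cellSet hc] at hp ⊢
    exact hp.trans h

theorem cellSet_injective {c : Space} (hc : ∀ d, 0 < c d) : Function.Injective (cellSet c) :=
  fun _ _ h => ((cellSet_subset_iff hc).1 h.subset).antisymm ((cellSet_subset_iff hc).1 h.symm.subset)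

theorem convex_cellSet (c : Space) (z : Cell) : Convex ℝ (cellSet c z) :=
  convex_pi fun _ _ => convex_Icc _ _

theorem isClosed_cellSet (c : Space) (z : Cell) : IsClosed (cellSet c z) :=
  isClosed_set_pi fun _ _ => isClosed_Icc

theorem cellSet_of_dim_zero {c : Space} {z : Cell} (hz : dim z = 0) :
    cellSet c z = {center c z} := by
  rw [dim_eq_zero_iff] at hz
  have : cellSet c z = Set.univ.pi fun d => {center c z d} := by
    unfold cellSet
    congr 1
    funext d
    have h := hz d
    have h2 : (z d : ℝ) = 2 * (z d / 2 : ℤ) := by exact_mod_cast (by omega : z d = 2 * (z d / 2))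
    rw [show (z d + 1) / 2 = z d / 2 by omega, Set.Icc_self, center, h2]
    congr 1
    ring
  rw [this, Set.univ_pi_singleton]

/-! ### Boxes as convex sets: vertices, edges, dimension. -/

theorem vertices_eq_pi (c : Space) (w : Cell) :
    center c '' {z | dim z = 0 ∧ IsFace z w} =
      Set.univ.pi fun d => {c d * (w d / 2 : ℤ), c d * ((w d + 1) / 2 : ℤ)} := by
  ext p
  simp only [Set.mem_image, Set.mem_ofPred_eq, Set.mem_univ_pi, Set.mem_insert_iff,
    Set.mem_singleton_iff]
  constructor
  · rintro ⟨z, ⟨hz, hf⟩, rfl⟩ d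
    have h := (dim_eq_zero_iff z).1 hz d
    have h2 : (z d : ℝ) = 2 * (z d / 2 : ℤ) := by exact_mod_cast (by omega : z d = 2 * (z d / 2))
    have h3 : center c z d = c d * (z d / 2 : ℤ) := by rw [center, h2]; ring
    have := hf d
    rcases (by omega : z d / 2 = w d / 2 ∨ z d / 2 = (w d + 1) / 2) with h4 | h4 <;> rw [h3, h4] <;>
      simp
  · intro h
    have h' : ∀ d, ∃ a : ℤ, p d = c d * a ∧ (a = w d / 2 ∨ a = (w d + 1) / 2) := by
      intro d
      rcases h d with h | h
      exacts [⟨_, h, Or.inl rfl⟩, ⟨_, h, Or.inr rfl⟩]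
    choose a ha ha' using h'
    refine ⟨fun d => 2 * a d, ⟨?_, ?_⟩, ?_⟩
    · rw [dim_eq_zero_iff]
      intro d
      omega
    · intro d
      have := ha' d
      simp only
      omega
    · funext d
      rw [center, ha d]
      push_cast
      ring

theorem mul_ediv_le {c : Space} (hc : ∀ d, 0 < c d) (w : Cell) (d : Fin 3) :
    c d * (w d / 2 : ℤ) ≤ c d * ((w d + 1) / 2 : ℤ) := by
  refine mul_le_mul_of_nonneg_left ?_ (hc d).le
  exact_mod_cast (by omega : w d / 2 ≤ (w d + 1) / 2)

theorem cellSet_eq_convexHull {c : Space} (hc : ∀ d, 0 < c d) (w : Cell) :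
    cellSet c w = convexHull ℝ (center c '' {z | dim z = 0 ∧ IsFace z w}) := by
  rw [vertices_eq_pi, convexHull_pi]
  unfold cellSet
  congr 1
  funext d
  rw [convexHull_pair, segment_eq_Icc (mul_ediv_le hc w d)]

theorem cellVertices_cellSet {c : Space} (hc : ∀ d, 0 < c d) (w : Cell) :
    cellVertices (cellSet c w) = center c '' {z | dim z = 0 ∧ IsFace z w} := by
  rw [vertices_eq_pi, cellVertices, cellSet, extremePoints_pi]
  congr 1
  funext d
  rw [Set.extremePoints_Icc (mul_ediv_le hc w d)]

theorem finite_setOf_isFace (w : Cell) : {z | IsFace z w}.Finite := by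
  refine (Set.Finite.pi' fun d : Fin 3 => Set.finite_Icc (w d - 1) (w d + 1)).subset ?_
  intro z hz d
  have := hz d
  simp only [Set.mem_Icc]
  omega

/-- In each coordinate the face is either the whole interval or one of its end points, and an end
point is a positive convex combination of points of the interval only trivially. -/
theorem isExtreme_cellSet {c : Space} (hc : ∀ d, 0 < c d) {z w : Cell} (h : IsFace z w) :
    IsExtreme ℝ (cellSet c w) (cellSet c z) := by
  refine ⟨(cellSet_subset_iff hc).2 h, ?_⟩
  rintro x hx y hy p hp ⟨s, t, hs, ht, hst, rfl⟩
  simp only [cellSet, Set.mem_univ_pi, Set.mem_Icc] at hx hy hp ⊢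
  intro d
  obtain ⟨hx1, hx2⟩ := hx d
  obtain ⟨hy1, hy2⟩ := hy d
  obtain ⟨hp1, hp2⟩ := hp d
  simp only [Pi.add_apply, Pi.smul_apply, smul_eq_mul] at hp1 hp2
  have hs' : s = 1 - t := by linarith
  have hd := h d
  constructor
  · by_cases h1 : z d / 2 = w d / 2
    · rwa [h1]
    · have e1 : z d / 2 = (w d + 1) / 2 := by omega
      rw [e1] at hp1 ⊢
      by_contra hlt
      push Not at hlt
      have := mul_pos hs (sub_pos.2 hlt)
      have := mul_nonneg ht.le (sub_nonneg.2 hy2)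
      subst hs'
      linarith
  · by_cases h1 : (z d + 1) / 2 = (w d + 1) / 2
    · rwa [h1]
    · have e1 : (z d + 1) / 2 = w d / 2 := by omega
      rw [e1] at hp2 ⊢
      by_contra hlt
      push Not at hlt
      have := mul_pos hs (sub_pos.2 hlt)
      have := mul_nonneg ht.le (sub_nonneg.2 hy1)
      subst hs'
      linarith

/-- The two end points of a one-dimensional cell. -/
theorem vertices_of_dim_one {z : Cell} (hz : dim z = 1) :
    {y | dim y = 0 ∧ IsFace y z} = {(fun d => 2 * (z d / 2)), (fun d => 2 * ((z d + 1) / 2))} := by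
  ext y
  simp only [Set.mem_ofPred_eq, Set.mem_insert_iff, Set.mem_singleton_iff, funext_iff,
    Fin.forall_fin_succ, isFace_iff, dim_eq, Fin.succ_zero_eq_one, Fin.succ_one_eq_two]
  rw [dim_eq] at hz
  simp only [IsEmpty.forall_iff, and_true]
  omega

theorem cellSet_of_dim_one {c : Space} (hc : ∀ d, 0 < c d) {z : Cell} (hz : dim z = 1) :
    cellSet c z = segment ℝ (center c fun d => 2 * (z d / 2))
      (center c fun d => 2 * ((z d + 1) / 2)) := by
  rw [cellSet_eq_convexHull hc, vertices_of_dim_one hz, Set.image_pair, convexHull_pair]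

/-- The end points of an extreme segment are vertices `u`, `v` of the box. If they differed in two
coordinates, exchanging one coordinate would give a third vertex on the segment; hence they differ
in exactly one, and the segment is the cell midway between them. -/
theorem polygonEdges_cellSet {c : Space} (hc : ∀ d, 0 < c d) (w : Cell) :
    polygonEdges (cellSet c w) = cellSet c '' {z | dim z = 1 ∧ IsFace z w} := by
  ext e
  constructor
  · rintro ⟨a, b, hab, rfl, he⟩
    have hsub : ∀ x ∈ Set.extremePoints ℝ (segment ℝ a b), x = a ∨ x = b := by
      intro x hx
      rw [← convexHull_pair] at hx
      simpa using extremePoints_convexHull_subset hx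
    have hcompact : IsCompact (segment ℝ a b) := by
      rw [← convexHull_pair]
      exact (Set.toFinite {a, b}).isCompact_convexHull ℝ
    have hull : closure (convexHull ℝ (Set.extremePoints ℝ (segment ℝ a b))) = segment ℝ a b :=
      closure_convexHull_extremePoints hcompact (convex_segment a b)
    -- By Krein–Milman the segment is the closed hull of its extreme points; without `a` that hull
    -- would lie in `{b}`.
    have ha : a ∈ Set.extremePoints ℝ (segment ℝ a b) := by
      by_contra hna
      have : segment ℝ a b ⊆ {b} := by
        rw [← hull]
        refine closure_minimal (convexHull_min ?_ (convex_singleton b)) isClosed_singleton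
        intro x hx
        rcases hsub x hx with rfl | h
        exacts [absurd hx hna, h]
      exact hab (this (left_mem_segment ℝ a b))
    have hb : b ∈ Set.extremePoints ℝ (segment ℝ a b) := by
      by_contra hnb
      have : segment ℝ a b ⊆ {a} := by
        rw [← hull]
        refine closure_minimal (convexHull_min ?_ (convex_singleton a)) isClosed_singleton
        intro x hx
        rcases hsub x hx with h | rfl
        exacts [h, absurd hx hnb]
      exact hab (this (right_mem_segment ℝ a b)).symm
    have hav := he.extremePoints_subset_extremePoints ha
    have hbv := he.extremePoints_subset_extremePoints hb
    change a ∈ cellVertices _ at hav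
    change b ∈ cellVertices _ at hbv
    rw [cellVertices_cellSet hc] at hav hbv
    obtain ⟨u, ⟨hu, huw⟩, rfl⟩ := hav
    obtain ⟨v, ⟨hv, hvw⟩, rfl⟩ := hbv
    have huv : u ≠ v := fun h => hab (by rw [h])
    -- Parallelogram argument: a vertex `y` of the box spanned by `u` and `v` and its reflection `u
    -- + v - y` have the same midpoint as `u` and `v`. This midpoint is on the segment, so
    -- extremality puts `y` there, and `y`, being extreme, is an end point.
    have key : ∀ y, dim y = 0 → IsFace y w → IsFace y (fun d => (u d + v d) / 2) → y = u ∨ y = v := by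
      intro y hy hyw hyz
      have hy' : IsFace (fun d => u d + v d - y d) w := by
        intro d
        have := hyz d
        have := huw d
        have := hvw d
        have := (dim_eq_zero_iff _).1 hu d
        have := (dim_eq_zero_iff _).1 hv d
        have := (dim_eq_zero_iff _).1 hy d
        simp only at *
        omega
      have hmid : midpoint ℝ (center c u) (center c v) =
          midpoint ℝ (center c y) (center c fun d => u d + v d - y d) := by
        funext d
        simp only [midpoint_eq_smul_add, center, Pi.smul_apply, Pi.add_apply, smul_eq_mul]
        push_cast
        ring
      have hyseg : center c y ∈ segment ℝ (center c u) (center c v) := by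
        refine he.left_mem_of_mem_openSegment ((center_mem_cellSet hc).2 hyw)
          ((center_mem_cellSet hc).2 hy') (midpoint_mem_segment (center c u) (center c v)) ?_
        rw [hmid]
        exact ⟨1 / 2, 1 / 2, by norm_num, by norm_num, by norm_num, by
          rw [midpoint_eq_smul_add, smul_add]; norm_num⟩
      have hyext : center c y ∈ Set.extremePoints ℝ (segment ℝ (center c u) (center c v)) := by
        rw [he.extremePoints_eq]
        refine ⟨hyseg, ?_⟩
        change _ ∈ cellVertices _
        rw [cellVertices_cellSet hc]
        exact ⟨y, ⟨hy, hyw⟩, rfl⟩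
      rcases hsub _ hyext with h | h
      exacts [Or.inl (center_injective hc h), Or.inr (center_injective hc h)]
    have hflip : ∀ d, u d ≠ v d → ∀ d', d' ≠ d → u d' = v d' := by
      intro d hd d' hd'
      have hy0 : dim (Function.update u d (v d)) = 0 := by
        rw [dim_eq_zero_iff]
        intro i
        have := (dim_eq_zero_iff _).1 hu i
        have := (dim_eq_zero_iff _).1 hv d
        by_cases h : i = d
        · subst h; simpa
        · rwa [Function.update_of_ne h]
      have hyw : IsFace (Function.update u d (v d)) w := by
        intro i
        by_cases h : i = d
        · subst h; simpa using hvw i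
        · rw [Function.update_of_ne h]; exact huw i
      have hyz : IsFace (Function.update u d (v d)) (fun d => (u d + v d) / 2) := by
        intro i
        have := huw i
        have := hvw i
        have := (dim_eq_zero_iff _).1 hu i
        have := (dim_eq_zero_iff _).1 hv i
        simp only
        by_cases h : i = d
        · subst h; rw [Function.update_self]; omega
        · rw [Function.update_of_ne h]; omega
      rcases key _ hy0 hyw hyz with h | h
      · have := congrFun h d
        rw [Function.update_self] at this
        exact absurd this.symm hd
      · have := congrFun h d'
        rwa [Function.update_of_ne hd'] at this
    have hz1 : dim (fun d => (u d + v d) / 2) = 1 := by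
      obtain ⟨d, hd⟩ : ∃ d, u d ≠ v d := by
        by_contra h
        push Not at h
        exact huv (funext h)
      have h1 : ∀ i, i ≠ d → ((u i + v i) / 2) % 2 = 0 := by
        intro i hi
        have := hflip d hd i hi
        have := (dim_eq_zero_iff _).1 hu i
        omega
      have h2 : ((u d + v d) / 2) % 2 = 1 := by
        have := huw d
        have := hvw d
        have := (dim_eq_zero_iff _).1 hu d
        have := (dim_eq_zero_iff _).1 hv d
        omega
      rw [dim, Finset.sum_eq_single d (fun i _ hi => h1 i hi) (by simp)]
      exact h2
    refine ⟨fun d => (u d + v d) / 2, ⟨hz1, ?_⟩, ?_⟩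
    · intro d
      have := huw d
      have := hvw d
      have := (dim_eq_zero_iff _).1 hu d
      have := (dim_eq_zero_iff _).1 hv d
      simp only
      omega
    · rw [cellSet_eq_convexHull hc, ← convexHull_pair, ← Set.image_pair]
      congr 2
      ext y
      have hz : ∀ d, (w d / 2 ≤ (u d + v d) / 2 / 2) ∧ ((u d + v d) / 2 + 1) / 2 ≤ (w d + 1) / 2 := by
        intro d
        have := huw d
        have := hvw d
        have := (dim_eq_zero_iff _).1 hu d
        have := (dim_eq_zero_iff _).1 hv d
        omega
      constructor
      · rintro ⟨hy, hyz⟩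
        exact key y hy (hyz.trans hz) hyz
      · rintro (rfl | rfl)
        · refine ⟨hu, fun d => ?_⟩
          have := huw d
          have := hvw d
          have := (dim_eq_zero_iff _).1 hu d
          have := (dim_eq_zero_iff _).1 hv d
          simp only
          omega
        · refine ⟨hv, fun d => ?_⟩
          have := huw d
          have := hvw d
          have := (dim_eq_zero_iff _).1 hu d
          have := (dim_eq_zero_iff _).1 hv d
          simp only
          omega
  · rintro ⟨z, ⟨hz, hzw⟩, rfl⟩
    refine ⟨_, _, ?_, cellSet_of_dim_one hc hz, isExtreme_cellSet hc hzw⟩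
    intro h
    have h' := center_injective hc h
    have h0 := congrFun h' 0
    have h1 := congrFun h' 1
    have h2 := congrFun h' 2
    rw [dim_eq] at hz
    omega

theorem isConvexPolygon_cellSet {c : Space} (hc : ∀ d, 0 < c d) {w : Cell} (hw : dim w = 2) :
    IsConvexPolygon (cellSet c w) := by
  have hfin : (center c '' {z | dim z = 0 ∧ IsFace z w}).Finite :=
    ((finite_setOf_isFace w).subset fun z hz => hz.2).image _
  refine ⟨⟨hfin.toFinset, by rw [hfin.coe_toFinset, cellSet_eq_convexHull hc]⟩, ?_⟩
  obtain ⟨d, hd, hd'⟩ : ∃ d, w d % 2 = 0 ∧ ∀ i, i ≠ d → w i % 2 = 1 := by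
    rw [dim_eq] at hw
    simp [Fin.exists_fin_succ, Fin.forall_fin_succ]
    omega
  have hspan : vectorSpan ℝ (cellSet c w) =
      LinearMap.ker (LinearMap.proj d : (Fin 3 → ℝ) →ₗ[ℝ] ℝ) := by
    refine le_antisymm ?_ ?_
    · rw [vectorSpan, Submodule.span_le]
      rintro _ ⟨p, hp, q, hq, rfl⟩
      simp only [cellSet, Set.mem_univ_pi] at hp hq
      have h1 := hp d
      have h2 := hq d
      rw [show (w d + 1) / 2 = w d / 2 by omega, Set.Icc_self, Set.mem_singleton_iff] at h1 h2
      simp [h1, h2]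
    · intro x hx
      have hxd : x d = 0 := hx
      rw [← Finset.univ_sum_single x]
      refine Submodule.sum_mem _ fun i _ => ?_
      by_cases hi : i = d
      · rw [hi, hxd, Pi.single_zero]
        exact Submodule.zero_mem _
      · have hw1 := hd' i hi
        have h1 : center c w ∈ cellSet c w := (center_mem_cellSet hc).2 (IsFace.refl w)
        have h2 : center c (Function.update w i (w i + 1)) ∈ cellSet c w := by
          refine (center_mem_cellSet hc).2 fun j => ?_
          by_cases hj : j = i
          · subst hj; rw [Function.update_self]; omega
          · rw [Function.update_of_ne hj]; omega
        have h3 := vsub_mem_vectorSpan ℝ h2 h1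
        -- A unit step in doubled coordinates moves the center by `c i / 2`, whence the factor `2 *
        -- x i / c i`.
        have h4 : (Pi.single i (x i) : Fin 3 → ℝ) = (2 * x i / c i) •
            (center c (Function.update w i (w i + 1)) -ᵥ center c w) := by
          funext j
          have hci := (hc i).ne'
          by_cases hj : j = i
          · subst hj
            simp only [Pi.single_eq_same, center, vsub_eq_sub, Pi.smul_apply, Pi.sub_apply,
              Function.update_self, smul_eq_mul]
            push_cast
            field_simp
            ring
          · simp [Pi.single_eq_of_ne hj, center, Function.update_of_ne hj]
        rw [h4]
        exact Submodule.smul_mem _ _ h3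
  rw [hspan]
  have := LinearMap.finrank_range_add_finrank_ker (LinearMap.proj d : (Fin 3 → ℝ) →ₗ[ℝ] ℝ)
  rw [LinearMap.range_eq_top.2 (LinearMap.proj_surjective d)] at this
  simp only [finrank_top, Module.finrank_self, Module.finrank_fintype_fun_eq_card,
    Fintype.card_fin] at this
  omega

theorem dim_eq_one_iff (z : Cell) : dim z = 1 ↔ (z 0 % 2 = 1 ∧ z 1 % 2 = 0 ∧ z 2 % 2 = 0) ∨
    (z 0 % 2 = 0 ∧ z 1 % 2 = 1 ∧ z 2 % 2 = 0) ∨ (z 0 % 2 = 0 ∧ z 1 % 2 = 0 ∧ z 2 % 2 = 1) := by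
  rw [dim_eq]
  omega

theorem dim_eq_two_iff (z : Cell) : dim z = 2 ↔ (z 0 % 2 = 0 ∧ z 1 % 2 = 1 ∧ z 2 % 2 = 1) ∨
    (z 0 % 2 = 1 ∧ z 1 % 2 = 0 ∧ z 2 % 2 = 1) ∨ (z 0 % 2 = 1 ∧ z 1 % 2 = 1 ∧ z 2 % 2 = 0) := by
  rw [dim_eq]
  omega

/-- The largest common face of two cells that meet. -/
def meet (z w : Cell) : Cell := fun d =>
  if z d = w d then z d else if z d % 2 = 0 then z d else if w d % 2 = 0 then w d
  -- Two different unit intervals that meet share only the grid point between them.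
  else (z d + w d) / 2

/-- The common face `x` certifies that the cells do meet; for disjoint cells `meet` has no geometric
meaning. -/
theorem isFace_meet_iff {x z w : Cell} (hz : IsFace x z) (hw : IsFace x w) (y : Cell) :
    IsFace y (meet z w) ↔ IsFace y z ∧ IsFace y w := by
  simp only [IsFace, ← forall_and]
  refine forall_congr' fun d => ?_
  have := hz d
  have := hw d
  simp only [meet]
  split_ifs <;> omega

theorem cellSet_inter {c : Space} (hc : ∀ d, 0 < c d) {x z w : Cell} (hz : IsFace x z)
    (hw : IsFace x w) : cellSet c z ∩ cellSet c w = cellSet c (meet z w) := by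
  ext p
  rw [Set.mem_inter_iff, mem_cellSet hc, mem_cellSet hc, mem_cellSet hc, isFace_meet_iff hz hw]

theorem glued_cellSet {c : Space} (hc : ∀ d, 0 < c d) {z w : Cell} (hz : dim z = 2)
    (hw : dim w = 2) (hne : z ≠ w) :
    cellSet c z ∩ cellSet c w = ∅ ∨
    (∃ v, v ∈ cellVertices (cellSet c z) ∧ v ∈ cellVertices (cellSet c w) ∧
      cellSet c z ∩ cellSet c w = {v}) ∨
    (∃ e, e ∈ polygonEdges (cellSet c z) ∧ e ∈ polygonEdges (cellSet c w) ∧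
      cellSet c z ∩ cellSet c w = e) := by
  rcases Set.eq_empty_or_nonempty (cellSet c z ∩ cellSet c w) with h | ⟨p, hp⟩
  · exact Or.inl h
  · right
    rw [Set.mem_inter_iff, mem_cellSet hc, mem_cellSet hc] at hp
    rw [cellSet_inter hc hp.1 hp.2, cellVertices_cellSet hc, cellVertices_cellSet hc,
      polygonEdges_cellSet hc z, polygonEdges_cellSet hc w]
    obtain ⟨h1, h2⟩ := (isFace_meet_iff hp.1 hp.2 _).1 (IsFace.refl (meet z w))
    have hlt : dim (meet z w) < 2 := by
      by_contra hge
      push Not at hge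
      exact hne ((h1.eq_of_dim_le (by omega)).symm.trans (h2.eq_of_dim_le (by omega)))
    have hnn : 0 ≤ dim (meet z w) := by rw [dim_eq]; omega
    rcases (by omega : dim (meet z w) = 0 ∨ dim (meet z w) = 1) with h0 | h0
    · left
      exact ⟨center c (meet z w), ⟨_, ⟨h0, h1⟩, rfl⟩, ⟨_, ⟨h0, h2⟩, rfl⟩, cellSet_of_dim_zero h0⟩
    · right
      exact ⟨cellSet c (meet z w), ⟨_, ⟨h0, h1⟩, rfl⟩, ⟨_, ⟨h0, h2⟩, rfl⟩, rfl⟩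

/-! ### The boundary of a finite union of cubes -/

/-- The three-dimensional cell with lower corner `b`. -/
def cube (b : Fin 3 → ℤ) : Cell := fun d => 2 * b d + 1

/-- The cube with lower corner `b` contains the cell `z`. -/
def Over (z : Cell) (b : Fin 3 → ℤ) : Prop := ∀ d, (z d - 1) / 2 ≤ b d ∧ b d ≤ z d / 2

/-- The cell `z` lies on the boundary of the union of the cubes with lower corners in `K`: it is
contained both in a cube of the family and in a cube that does not belong to it. -/
def IsBoundary (K : Set (Fin 3 → ℤ)) (z : Cell) : Prop := (∃ b ∈ K, Over z b) ∧ ∃ b ∉ K, Over z b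

/-- The squares on the boundary of a union of cubes. -/
def boundarySquares (K : Set (Fin 3 → ℤ)) : Set Cell := {w | dim w = 2 ∧ IsBoundary K w}

theorem isFace_cube_iff {z : Cell} {b : Fin 3 → ℤ} : IsFace z (cube b) ↔ Over z b := by
  refine forall_congr' fun d => ?_
  simp only [cube]
  omega

theorem Over.mono {z w : Cell} {b : Fin 3 → ℤ} (h : IsFace z w) (hb : Over w b) : Over z b :=
  isFace_cube_iff.1 (h.trans (isFace_cube_iff.2 hb))

theorem IsBoundary.mono {K : Set (Fin 3 → ℤ)} {z w : Cell} (h : IsFace z w)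
    (hw : IsBoundary K w) : IsBoundary K z := by
  obtain ⟨⟨b, hb, hwb⟩, b', hb', hwb'⟩ := hw
  exact ⟨⟨b, hb, hwb.mono h⟩, b', hb', hwb'.mono h⟩

/-- Two cubes at `z` that differ only in direction `d` are adjacent; when exactly one of them is
filled, the square between them is on the boundary and contains `z`. -/
theorem exists_square_of_update {K : Set (Fin 3 → ℤ)} {z : Cell} {b : Fin 3 → ℤ} (hb : b ∈ K)
    (hz : Over z b) (d : Fin 3) {t : ℤ} (ht : (z d - 1) / 2 ≤ t ∧ t ≤ z d / 2)
    (hK : Function.update b d t ∉ K) : ∃ w ∈ boundarySquares K, IsFace z w := by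
  have hne : b d ≠ t := by
    rintro rfl
    rw [Function.update_eq_self] at hK
    exact hK hb
  have hd := hz d
  have hzd : z d % 2 = 0 := by omega
  refine ⟨Function.update (cube b) d (z d), ⟨?_, ⟨b, hb, ?_⟩, _, hK, ?_⟩, ?_⟩
  · rw [dim_eq_two_iff]
    fin_cases d <;> simp_all [cube, Function.update]
  · intro i
    by_cases h : i = d
    · subst h; rw [Function.update_self]; exact hd
    · rw [Function.update_of_ne h, cube]; omega
  · intro i
    by_cases h : i = d
    · subst h; rw [Function.update_self, Function.update_self]; exact ht
    · rw [Function.update_of_ne h, Function.update_of_ne h, cube]; omega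
  · intro i
    by_cases h : i = d
    · subst h; rw [Function.update_self]; exact ⟨le_rfl, le_rfl⟩
    · have := hz i
      rw [Function.update_of_ne h, cube]; omega

/-- Walk from a filled cube at `z` to an empty one by changing one coordinate at a time. All cubes
on the way contain `z`, and some step must leave `K`. So the boundary complex is pure of dimension
two. -/
theorem IsBoundary.exists_square {K : Set (Fin 3 → ℤ)} {z : Cell} (hz : IsBoundary K z) :
    ∃ w ∈ boundarySquares K, IsFace z w := by
  by_contra hno
  obtain ⟨⟨b, hb, hzb⟩, b', hb', hzb'⟩ := hz
  have step : ∀ u ∈ K, Over z u → ∀ d, Function.update u d (b' d) ∈ K ∧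
      Over z (Function.update u d (b' d)) := by
    intro u hu hzu d
    refine ⟨?_, fun i => ?_⟩
    · by_contra h
      exact hno (exists_square_of_update hu hzu d (hzb' d) h)
    · by_cases h : i = d
      · subst h; rw [Function.update_self]; exact hzb' i
      · rw [Function.update_of_ne h]; exact hzu i
  obtain ⟨h1, h1'⟩ := step b hb hzb 0
  obtain ⟨h2, h2'⟩ := step _ h1 h1' 1
  obtain ⟨h3, -⟩ := step _ h2 h2' 2
  refine hb' ?_
  convert h3 using 1
  funext i
  fin_cases i <;> simp [Function.update]

theorem finite_setOf_isBoundary {K : Set (Fin 3 → ℤ)} (hK : K.Finite) :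
    {z | IsBoundary K z}.Finite := by
  refine (hK.biUnion fun b _ => finite_setOf_isFace (cube b)).subset ?_
  rintro z ⟨⟨b, hb, hz⟩, -⟩
  exact Set.mem_biUnion hb (isFace_cube_iff.2 hz)

theorem carrier_ediv {c p : Space} (d : Fin 3) : carrier c p d / 2 = ⌊p d / c d⌋ ∧
    (carrier c p d + 1) / 2 = ⌈p d / c d⌉ := by
  have h1 := Int.floor_le_ceil (p d / c d)
  have h2 := Int.ceil_le_floor_add_one (p d / c d)
  simp only [carrier]
  omega

/-- The floor is upper and the ceiling lower semicontinuous, so the points near `p` lie in the open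
star of the carrier of `p`. -/
theorem eventually_isFace_carrier {c : Space} (p : Space) :
    ∀ᶠ q in nhds p, IsFace (carrier c p) (carrier c q) := by
  simp only [IsFace, Filter.eventually_all]
  intro d
  have hcont : Continuous fun q : Space => q d / c d := by fun_prop
  have h1 : ∀ᶠ q : Space in nhds p, q d / c d < ⌊p d / c d⌋ + 1 :=
    hcont.continuousAt.eventually_lt_const (Int.lt_floor_add_one _)
  have h2 : ∀ᶠ q : Space in nhds p, (⌈p d / c d⌉ : ℝ) - 1 < q d / c d :=
    hcont.continuousAt.eventually_const_lt (by linarith [Int.ceil_lt_add_one (p d / c d)])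
  filter_upwards [h1, h2] with q hq1 hq2
  rw [(carrier_ediv d).1, (carrier_ediv d).1, (carrier_ediv d).2, (carrier_ediv d).2]
  refine ⟨Int.floor_le_iff.2 hq1, ?_⟩
  have := hq2.trans_le (Int.le_ceil (q d / c d))
  have : ⌈p d / c d⌉ - 1 < ⌈q d / c d⌉ := by exact_mod_cast this
  omega

theorem carrier_of_mem_openSegment {c : Space} (hc : ∀ d, 0 < c d) {p q : Space}
    {b : Fin 3 → ℤ} (hp : p ∈ cellSet c (cube b))
    (hq : q ∈ openSegment ℝ (center c (cube b)) p) : carrier c q = cube b := by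
  obtain ⟨s, t, hs, ht, hst, rfl⟩ := hq
  funext d
  simp only [cellSet, Set.mem_univ_pi, Set.mem_Icc, cube] at hp
  have hd := hp d
  rw [show (2 * b d + 1) / 2 = b d by omega, show (2 * b d + 1 + 1) / 2 = b d + 1 by omega] at hd
  have hcd := hc d
  have hs' : s = 1 - t := by linarith
  set r := p d / c d with hr
  have hpr : p d = c d * r := by rw [hr]; field_simp
  rw [hpr, mul_le_mul_iff_right₀ hcd, mul_le_mul_iff_right₀ hcd] at hd
  have heq : (s • center c (cube b) + t • p) d / c d = b d + s / 2 + t * (r - b d) := by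
    simp only [Pi.add_apply, Pi.smul_apply, center, cube, smul_eq_mul, hpr]
    push_cast
    field_simp
    rw [hs']
    ring
  push_cast at hd
  have h1 := mul_nonneg ht.le (sub_nonneg.2 hd.1)
  have h2 := mul_nonneg ht.le (sub_nonneg.2 hd.2)
  have hfl : ⌊(s • center c (cube b) + t • p) d / c d⌋ = b d := by
    rw [Int.floor_eq_iff, heq]
    constructor <;> nlinarith
  have hce : ⌈(s • center c (cube b) + t • p) d / c d⌉ = b d + 1 := by
    rw [Int.ceil_eq_iff, heq]
    push_cast
    constructor <;> nlinarith
  rw [carrier, hfl, hce, cube]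
  ring

/-- The boundary of a finite union of cubes is the union of its boundary squares. -/
theorem frontier_iUnion_cube {c : Space} (hc : ∀ d, 0 < c d) {K : Set (Fin 3 → ℤ)}
    (hK : K.Finite) : frontier (⋃ b ∈ K, cellSet c (cube b)) =
      ⋃₀ (cellSet c '' boundarySquares K) := by
  set S := ⋃ b ∈ K, cellSet c (cube b) with hS
  have hmem : ∀ p, p ∈ S ↔ ∃ b ∈ K, Over (carrier c p) b := by
    intro p
    simp only [hS, Set.mem_iUnion, exists_prop, mem_cellSet hc, isFace_cube_iff]
  have hclosed : IsClosed S := hK.isClosed_biUnion fun b _ => isClosed_cellSet c _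
  rw [frontier_eq_closure_inter_closure, hclosed.closure_eq]
  ext p
  simp only [Set.sUnion_image, Set.mem_iUnion, exists_prop, Set.mem_inter_iff]
  constructor
  · rintro ⟨hp, hp'⟩
    have hbd : IsBoundary K (carrier c p) := by
      refine ⟨(hmem p).1 hp, ?_⟩
      by_contra hno
      push Not at hno
      rw [mem_closure_iff_frequently] at hp'
      -- If all cubes at `p` were filled, so would be all cubes at nearby points, and `p` would be
      -- interior.
      refine hp' ((eventually_isFace_carrier (c := c) p).mono fun q hq hqS => hqS ?_)
      have hover : Over (carrier c q) (fun d => carrier c q d / 2) := by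
        intro d
        simp only
        omega
      refine (hmem q).2 ⟨_, ?_, hover⟩
      by_contra hqK
      exact hno _ hqK (hover.mono hq)
    obtain ⟨w, hw, hpw⟩ := hbd.exists_square
    exact ⟨w, hw, (mem_cellSet hc).2 hpw⟩
  · rintro ⟨w, ⟨-, ⟨b, hb, hwb⟩, b', hb', hwb'⟩, hp⟩
    have hpw := (mem_cellSet hc).1 hp
    refine ⟨(hmem p).2 ⟨b, hb, hwb.mono hpw⟩, ?_⟩
    have hp' : p ∈ cellSet c (cube b') := (mem_cellSet hc).2 (isFace_cube_iff.2 (hwb'.mono hpw))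
    -- The open segment from the center of the empty cube to `p` runs in the interior of that cube,
    -- hence outside the solid, and `p` is in its closure.
    have hsub : openSegment ℝ (center c (cube b')) p ⊆ Sᶜ := by
      intro q hq hqS
      obtain ⟨u, hu, hqu⟩ := (hmem q).1 hqS
      rw [carrier_of_mem_openSegment hc hp' hq] at hqu
      refine hb' ?_
      convert hu using 1
      funext d
      have := hqu d
      simp only [cube] at this
      omega
    refine closure_mono hsub ?_
    rw [closure_openSegment]
    exact right_mem_segment ℝ _ _

/-- The polyhedron formed by the boundary squares of a finite union of cubes. -/
noncomputable def boundaryPolyhedron (c : Space) (hc : ∀ d, 0 < c d) (K : Set (Fin 3 → ℤ))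
    (hK : K.Finite) : Polyhedron where
  faces := cellSet c '' boundarySquares K
  finite_faces := ((finite_setOf_isBoundary hK).subset fun _ hz => hz.2).image _
  isConvexPolygon := by
    rintro _ ⟨w, hw, rfl⟩
    exact isConvexPolygon_cellSet hc hw.1
  glued := by
    rintro _ ⟨w, hw, rfl⟩ _ ⟨z, hz, rfl⟩ hne
    exact glued_cellSet hc hw.1 hz.1 fun h => hne (by rw [h])

theorem vertices_boundaryPolyhedron {c : Space} (hc : ∀ d, 0 < c d) {K : Set (Fin 3 → ℤ)}
    (hK : K.Finite) : (boundaryPolyhedron c hc K hK).vertices =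
    center c '' {z | dim z = 0 ∧ IsBoundary K z} := by
  ext p
  constructor
  · rintro ⟨_, ⟨w, hw, rfl⟩, hp⟩
    rw [cellVertices_cellSet hc] at hp
    obtain ⟨z, ⟨hz, hzw⟩, rfl⟩ := hp
    exact ⟨z, ⟨hz, hw.2.mono hzw⟩, rfl⟩
  · rintro ⟨z, ⟨hz, hb⟩, rfl⟩
    obtain ⟨w, hw, hzw⟩ := hb.exists_square
    refine ⟨_, ⟨w, hw, rfl⟩, ?_⟩
    rw [cellVertices_cellSet hc]
    exact ⟨z, ⟨hz, hzw⟩, rfl⟩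

theorem edges_boundaryPolyhedron {c : Space} (hc : ∀ d, 0 < c d) {K : Set (Fin 3 → ℤ)}
    (hK : K.Finite) : (boundaryPolyhedron c hc K hK).edges =
    cellSet c '' {z | dim z = 1 ∧ IsBoundary K z} := by
  ext p
  constructor
  · rintro ⟨_, ⟨w, hw, rfl⟩, hp⟩
    rw [polygonEdges_cellSet hc] at hp
    obtain ⟨z, ⟨hz, hzw⟩, rfl⟩ := hp
    exact ⟨z, ⟨hz, hw.2.mono hzw⟩, rfl⟩
  · rintro ⟨z, ⟨hz, hb⟩, rfl⟩
    obtain ⟨w, hw, hzw⟩ := hb.exists_square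
    refine ⟨_, ⟨w, hw, rfl⟩, ?_⟩
    rw [polygonEdges_cellSet hc]
    exact ⟨z, ⟨hz, hzw⟩, rfl⟩

theorem eulerChar_boundaryPolyhedron {c : Space} (hc : ∀ d, 0 < c d) {K : Set (Fin 3 → ℤ)}
    (hK : K.Finite) : (boundaryPolyhedron c hc K hK).eulerChar =
    ({z | dim z = 0 ∧ IsBoundary K z}.ncard : ℤ) - ({z | dim z = 1 ∧ IsBoundary K z}.ncard : ℤ)
      + ({z | dim z = 2 ∧ IsBoundary K z}.ncard : ℤ) := by
  rw [Polyhedron.eulerChar, vertices_boundaryPolyhedron, edges_boundaryPolyhedron,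
    Set.ncard_image_of_injective _ (center_injective hc),
    Set.ncard_image_of_injective _ (cellSet_injective hc)]
  congr 2
  exact Set.ncard_image_of_injective _ (cellSet_injective hc)

theorem support_boundaryPolyhedron {c : Space} (hc : ∀ d, 0 < c d) {K : Set (Fin 3 → ℤ)}
    (hK : K.Finite) : (boundaryPolyhedron c hc K hK).support =
    frontier (⋃ b ∈ K, cellSet c (cube b)) := by
  rw [frontier_iUnion_cube hc hK]
  rfl

/-! ### Links of vertices and a combinatorial criterion for closed surfaces. -/

/-- Two boundary squares at the vertex `v` are adjacent if they share an edge at `v`. -/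
def LinkAdj (K : Set (Fin 3 → ℤ)) (v f g : Cell) : Prop :=
  (f ∈ boundarySquares K ∧ IsFace v f) ∧ (g ∈ boundarySquares K ∧ IsFace v g) ∧
    ∃ e, dim e = 1 ∧ IsFace v e ∧ IsFace e f ∧ IsFace e g

/-- The part of the link of `v` contained in the square `f`. -/
def linkPart (c : Space) (v f : Cell) : Set Space :=
  ⋃₀ (cellSet c '' {e | dim e = 1 ∧ IsFace e f ∧ ¬ IsFace v e})

/-- The two sides of the square that avoid `v` meet in the corner opposite to `v`, which in doubled
coordinates is `2 * f - v`. -/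
theorem isPreconnected_linkPart {c : Space} (hc : ∀ d, 0 < c d)
    {v f : Cell} (hv : dim v = 0) (hf : dim f = 2)
    (hvf : IsFace v f) : IsPreconnected (linkPart c v f) := by
  refine isPreconnected_sUnion (center c fun d => 2 * f d - v d) _ ?_ ?_
  · rintro _ ⟨e, ⟨he, hef, hve⟩, rfl⟩
    rw [center_mem_cellSet hc]
    rw [dim_eq_zero_iff] at hv
    have h1 : ∀ d, f d % 2 = 0 → v d = e d ∧ 2 * f d - v d = e d := by
      intro d h
      have := hvf d
      have := hef d
      omega
    have h2 : ∀ d, f d % 2 = 1 → e d % 2 = 1 → (e d / 2 ≤ v d / 2 ∧ (v d + 1) / 2 ≤ (e d + 1) / 2) ∧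
        e d / 2 ≤ (2 * f d - v d) / 2 ∧ (2 * f d - v d + 1) / 2 ≤ (e d + 1) / 2 := by
      intro d h h'
      have := hv d
      have := hvf d
      have := hef d
      omega
    have h3 : ∀ d, f d % 2 = 1 → e d % 2 = 0 → v d = e d ∨ 2 * f d - v d = e d := by
      intro d h h'
      have := hv d
      have := hvf d
      have := hef d
      omega
    have hodd : ∀ d, e d % 2 = 1 → f d % 2 = 1 := by
      intro d h
      have := hef d
      omega
    intro d
    by_contra hd
    simp only at hd
    have hfd : f d % 2 = 1 := by
      by_contra h
      have := h1 d (by omega)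
      omega
    have hed : e d % 2 = 0 := by
      by_contra h
      exact hd (h2 d hfd (by omega)).2
    refine hve fun i => ?_
    by_cases hi : i = d
    · subst hi
      have := h3 i hfd hed
      omega
    · by_cases hfi : f i % 2 = 1
      · refine (h2 i hfi ?_).1
        by_contra hei
        have hall : ∀ j, e j % 2 = 0 := by
          intro j
          by_contra hj
          have hfj := hodd j (by omega)
          have hji : j ≠ i := by rintro rfl; omega
          have hjd : j ≠ d := by rintro rfl; omega
          rw [dim_eq_two_iff] at hf
          fin_cases i <;> fin_cases d <;> fin_cases j <;> simp at hi hji hjd hfi hfd hfj <;> omega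
        rw [(dim_eq_zero_iff e).2 hall] at he
        omega
      · have := h1 i (by omega)
        omega
  · rintro _ ⟨e, -, rfl⟩
    exact (convex_cellSet c e).isPreconnected

/-- `2 * e - v` is the end of `e` other than `v`, and `f + e - v` is the other side of `f` through
it. Squares sharing an edge at `v` therefore have intersecting link parts. -/
theorem center_mem_linkPart {c : Space} (hc : ∀ d, 0 < c d)
    {v e f : Cell} (hv : dim v = 0) (he : dim e = 1) (hf : dim f = 2)
    (hve : IsFace v e) (hef : IsFace e f) :
    center c (fun d => 2 * e d - v d) ∈ linkPart c v f := by
  rw [dim_eq_zero_iff] at hv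
  have hodd : ∀ d, e d % 2 = 1 → f d % 2 = 1 := by
    intro d h
    have := hef d
    omega
  refine ⟨_, ⟨fun d => f d + e d - v d, ⟨?_, ?_, ?_⟩, rfl⟩, ?_⟩
  · have := hodd 0
    have := hodd 1
    have := hodd 2
    have := hv 0
    have := hv 1
    have := hv 2
    rw [dim_eq_two_iff] at hf
    rw [dim_eq_one_iff] at he ⊢
    omega
  · intro d
    have := hv d
    have := hve d
    have := hef d
    simp only
    omega
  · intro h
    obtain ⟨d, hd⟩ : ∃ d, e d % 2 = 1 := by
      by_contra hno
      push Not at hno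
      rw [(dim_eq_zero_iff e).2 fun d => by have := hno d; omega] at he
      omega
    have := hv d
    have := hve d
    have := hef d
    have := h d
    simp only at this
    omega
  · rw [center_mem_cellSet hc]
    intro d
    have := hv d
    have := hve d
    have := hef d
    simp only
    omega

theorem link_boundaryPolyhedron {c : Space} (hc : ∀ d, 0 < c d) {K : Set (Fin 3 → ℤ)}
    (hK : K.Finite) {v : Cell} (hv : dim v = 0) :
    ⋃₀ (boundaryPolyhedron c hc K hK).link (center c v) =
      ⋃ f ∈ {f | f ∈ boundarySquares K ∧ IsFace v f}, linkPart c v f := by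
  have hvert : ∀ w, center c v ∈ cellVertices (cellSet c w) ↔ IsFace v w := by
    intro w
    rw [cellVertices_cellSet hc]
    constructor
    · rintro ⟨z, ⟨-, hz⟩, h⟩
      rwa [← center_injective hc h]
    · intro h
      exact ⟨v, ⟨hv, h⟩, rfl⟩
  ext p
  simp only [Set.mem_sUnion, Set.mem_iUnion, exists_prop, linkPart]
  constructor
  · rintro ⟨_, ⟨_, ⟨f, hf, rfl⟩, he, hvf, hve⟩, hp⟩
    rw [polygonEdges_cellSet hc] at he
    obtain ⟨e, ⟨he, hef⟩, rfl⟩ := he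
    rw [hvert] at hvf hve
    exact ⟨f, ⟨hf, hvf⟩, _, ⟨e, ⟨he, hef, hve⟩, rfl⟩, hp⟩
  · rintro ⟨f, ⟨hf, hvf⟩, _, ⟨e, ⟨he, hef, hve⟩, rfl⟩, hp⟩
    refine ⟨_, ⟨_, ⟨f, hf, rfl⟩, ?_, (hvert f).2 hvf, fun h => hve ((hvert e).1 h)⟩, hp⟩
    rw [polygonEdges_cellSet hc]
    exact ⟨e, ⟨he, hef⟩, rfl⟩

/-- The boundary of a finite union of cubes is a closed surface if every boundary edge lies on
exactly two boundary squares, and the boundary squares at a vertex are connected via edges. -/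
theorem isClosedSurface_boundaryPolyhedron {c : Space} (hc : ∀ d, 0 < c d) {K : Set (Fin 3 → ℤ)}
    (hK : K.Finite)
    (hedge : ∀ z, dim z = 1 → IsBoundary K z → {w | w ∈ boundarySquares K ∧ IsFace z w}.ncard = 2)
    (hlink : ∀ v, dim v = 0 → ∀ f g, (f ∈ boundarySquares K ∧ IsFace v f) →
      (g ∈ boundarySquares K ∧ IsFace v g) → Relation.ReflTransGen (LinkAdj K v) f g) :
    (boundaryPolyhedron c hc K hK).IsClosedSurface := by
  constructor
  · intro e he
    rw [edges_boundaryPolyhedron] at he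
    obtain ⟨z, ⟨hz, hb⟩, rfl⟩ := he
    rw [← hedge z hz hb, ← Set.ncard_image_of_injective _ (cellSet_injective hc)]
    congr 1
    ext q
    constructor
    · rintro ⟨⟨w, hw, rfl⟩, hq⟩
      rw [polygonEdges_cellSet hc] at hq
      obtain ⟨y, ⟨-, hyw⟩, hy⟩ := hq
      rw [cellSet_injective hc hy] at hyw
      exact ⟨w, ⟨hw, hyw⟩, rfl⟩
    · rintro ⟨w, ⟨hw, hzw⟩, rfl⟩
      refine ⟨⟨w, hw, rfl⟩, ?_⟩
      rw [polygonEdges_cellSet hc]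
      exact ⟨z, ⟨hz, hzw⟩, rfl⟩
  · intro p hp
    rw [vertices_boundaryPolyhedron] at hp
    obtain ⟨v, ⟨hv, hb⟩, rfl⟩ := hp
    rw [link_boundaryPolyhedron hc hK hv]
    constructor
    · obtain ⟨f, hf, hvf⟩ := hb.exists_square
      obtain ⟨e, he, hve, hef⟩ : ∃ e, dim e = 1 ∧ IsFace v e ∧ IsFace e f := by
        have hf1 := hf.1
        rw [dim_eq] at hv hf1
        rw [isFace_iff] at hvf
        by_cases h0 : f 0 % 2 = 1
        · refine ⟨![f 0, v 1, v 2], ?_⟩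
          simp only [dim_eq, isFace_iff, Matrix.cons_val]
          omega
        · refine ⟨![v 0, f 1, v 2], ?_⟩
          simp only [dim_eq, isFace_iff, Matrix.cons_val]
          omega
      exact ⟨_, Set.mem_biUnion (show f ∈ {f | f ∈ boundarySquares K ∧ IsFace v f} from ⟨hf, hvf⟩)
        (center_mem_linkPart hc hv he hf.1 hve hef)⟩
    · refine IsPreconnected.biUnion_of_reflTransGen
        (fun f hf => isPreconnected_linkPart hc hv hf.1.1 hf.2) fun f hf g hg => ?_
      refine Relation.ReflTransGen.mono ?_ _ _ (hlink v hv f g hf hg)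
      rintro a b ⟨ha, hb, e, he, hve, hea, heb⟩
      exact ⟨⟨_, center_mem_linkPart hc hv he ha.1.1 hve hea,
        center_mem_linkPart hc hv he hb.1.1 hve heb⟩, ha⟩

/-- The boundary of a finite union of cubes is connected if its boundary cells are connected via
incidences. -/
theorem isConnected_frontier {c : Space} (hc : ∀ d, 0 < c d) {K : Set (Fin 3 → ℤ)}
    (hK : K.Finite) (hne : ∃ z, IsBoundary K z)
    (hconn : ∀ f g, IsBoundary K f → IsBoundary K g →
      Relation.ReflTransGen (fun a b => IsBoundary K a ∧ IsBoundary K b ∧ (IsFace a b ∨ IsFace b a))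
        f g) :
    IsConnected (frontier (⋃ b ∈ K, cellSet c (cube b))) := by
  have heq : ⋃₀ (cellSet c '' boundarySquares K) = ⋃ z ∈ {z | IsBoundary K z}, cellSet c z := by
    ext p
    simp only [Set.sUnion_image, Set.mem_iUnion, exists_prop]
    constructor
    · rintro ⟨w, hw, hp⟩
      exact ⟨w, hw.2, hp⟩
    · rintro ⟨z, hz, hp⟩
      obtain ⟨w, hw, hzw⟩ := IsBoundary.exists_square hz
      exact ⟨w, hw, (cellSet_subset_iff hc).2 hzw hp⟩
  have hcen : ∀ z, center c z ∈ cellSet c z := fun z => (center_mem_cellSet hc).2 (IsFace.refl z)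
  rw [frontier_iUnion_cube hc hK, heq]
  refine IsConnected.biUnion_of_reflTransGen hne
    (fun z _ => ⟨⟨_, hcen z⟩, (convex_cellSet c z).isPreconnected⟩) fun f hf g hg => ?_
  refine Relation.ReflTransGen.mono ?_ _ _ (hconn f g hf hg)
  rintro a b ⟨ha, -, hab | hba⟩
  · exact ⟨⟨_, hcen a, (cellSet_subset_iff hc).2 hab (hcen a)⟩, ha⟩
  · exact ⟨⟨_, (cellSet_subset_iff hc).2 hba (hcen b), hcen b⟩, ha⟩

/-! ### The local structure of a stack of levels -/

/-- The offsets of the twelve squares at a vertex of the grid. -/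
def squareOffset : Fin 12 → Cell :=
  ![![0, -1, -1], ![0, -1, 1], ![0, 1, -1], ![0, 1, 1], ![-1, 0, -1], ![-1, 0, 1], ![1, 0, -1],
    ![1, 0, 1], ![-1, -1, 0], ![-1, 1, 0], ![1, -1, 0], ![1, 1, 0]]

/-- The offsets of the six edges at a vertex of the grid. -/
def edgeOffset : Fin 6 → Cell :=
  ![![-1, 0, 0], ![1, 0, 0], ![0, -1, 0], ![0, 1, 0], ![0, 0, -1], ![0, 0, 1]]

instance (z w : Cell) : Decidable (IsFace z w) := by unfold IsFace; infer_instance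

theorem dim_squareOffset : ∀ k, dim (squareOffset k) = 2 := by decide +kernel

theorem dim_edgeOffset : ∀ j, dim (edgeOffset j) = 1 := by decide +kernel

theorem isFace_zero_squareOffset : ∀ k, IsFace 0 (squareOffset k) := by decide +kernel

theorem isFace_zero_edgeOffset : ∀ j, IsFace 0 (edgeOffset j) := by decide +kernel

theorem squareOffset_injective : Function.Injective squareOffset := by decide +kernel

theorem exists_squareOffset : ∀ x ∈ Finset.Icc (-1 : ℤ) 1, ∀ y ∈ Finset.Icc (-1 : ℤ) 1,
    ∀ z ∈ Finset.Icc (-1 : ℤ) 1, dim ![x, y, z] = 2 → ∃ k, squareOffset k = ![x, y, z] := by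
  decide +kernel

/-- The sets of neighbours of the twelve squares at a vertex, as bit masks. -/
def neighbourMask : Fin 12 → ℕ :=
  ![1366, 1449, 2649, 2726, 869, 922, 3221, 3178, 1587, 2364, 2499, 1740]

/-- This justifies the numerals in `neighbourMask`. Only this implication is needed: the masks serve
to produce adjacencies, never to exclude them. -/
theorem exists_common_edge : ∀ k l : Fin 12, (neighbourMask k).testBit l →
    ∃ j, IsFace (edgeOffset j) (squareOffset k) ∧ IsFace (edgeOffset j) (squareOffset l) := by
  decide +kernel

theorem isFace_add_iff {v : Cell} (hv : dim v = 0) (z w : Cell) :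
    IsFace (v + z) (v + w) ↔ IsFace z w := by
  rw [dim_eq_zero_iff] at hv
  refine forall_congr' fun d => ?_
  have := hv d
  simp only [Pi.add_apply]
  omega

theorem dim_add {v : Cell} (hv : dim v = 0) (z : Cell) : dim (v + z) = dim z := by
  rw [dim_eq_zero_iff] at hv
  refine Finset.sum_congr rfl fun d _ => ?_
  have := hv d
  simp only [Pi.add_apply]
  omega

theorem exists_eq_add_squareOffset {v f : Cell} (hv : dim v = 0) (hf : dim f = 2)
    (h : IsFace v f) : ∃ k, f = v + squareOffset k := by
  have hf' : f = v + ![f 0 - v 0, f 1 - v 1, f 2 - v 2] := by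
    funext d
    fin_cases d <;> simp
  have hmem : ∀ d, f d - v d ∈ Finset.Icc (-1 : ℤ) 1 := by
    intro d
    have := h d
    rw [Finset.mem_Icc]
    omega
  rw [hf', dim_add hv] at hf
  obtain ⟨k, hk⟩ := exists_squareOffset _ (hmem 0) _ (hmem 1) _ (hmem 2) hf
  exact ⟨k, by rw [hk]; exact hf'⟩

/-- The lower one of the two cubes at a vertex that are adjacent to a given square. -/
def lowerSide : Fin 12 → Fin 3 → Bool :=
  ![![false, false, false], ![false, false, true], ![false, true, false],
    ![false, true, true], ![false, false, false], ![false, false, true],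
    ![true, false, false], ![true, false, true], ![false, false, false],
    ![false, true, false], ![true, false, false], ![true, true, false]]

/-- The upper one of the two cubes at a vertex that are adjacent to a given square. -/
def upperSide : Fin 12 → Fin 3 → Bool :=
  ![![true, false, false], ![true, false, true], ![true, true, false],
    ![true, true, true], ![false, true, false], ![false, true, true],
    ![true, true, false], ![true, true, true], ![false, false, true],
    ![false, true, true], ![true, false, true], ![true, true, true]]

/-- The lower corners of the eight cubes at a vertex. -/
def corner (v : Cell) (s : Fin 3 → Bool) : Fin 3 → ℤ := fun d => v d / 2 - cond (s d) 0 1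

theorem over_add_squareOffset_iff {v : Cell} (hv : dim v = 0) (k : Fin 12) (b : Fin 3 → ℤ) :
    Over (v + squareOffset k) b ↔ b = corner v (lowerSide k) ∨ b = corner v (upperSide k) := by
  rw [dim_eq_zero_iff] at hv
  have := hv 0
  have := hv 1
  have := hv 2
  fin_cases k <;>
    simp [Over, corner, lowerSide, upperSide, squareOffset, Fin.forall_fin_succ, funext_iff] <;>
    omega

/-- Given which of the eight cubes at a vertex are occupied, decide which of the twelve squares at
the vertex are boundary squares. -/
def mixed (o : (Fin 3 → Bool) → Bool) (k : Fin 12) : Bool := o (lowerSide k) ^^ o (upperSide k)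

theorem add_squareOffset_mem_iff {v : Cell} (hv : dim v = 0) {K : Set (Fin 3 → ℤ)}
    {o : (Fin 3 → Bool) → Bool} (ho : ∀ s, o s = true ↔ corner v s ∈ K) (k : Fin 12) :
    v + squareOffset k ∈ boundarySquares K ↔ mixed o k = true := by
  simp only [boundarySquares, Set.mem_ofPred_eq, dim_add hv, dim_squareOffset, IsBoundary,
    over_add_squareOffset_iff hv, mixed, true_and]
  have h1 := ho (lowerSide k)
  have h2 := ho (upperSide k)
  constructor
  · rintro ⟨⟨b, hb, rfl | rfl⟩, b', hb', rfl | rfl⟩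
    · exact absurd hb hb'
    · rw [h1.2 hb, Bool.eq_false_iff.2 fun h => hb' (h2.1 h)]; rfl
    · rw [h2.2 hb, Bool.eq_false_iff.2 fun h => hb' (h1.1 h)]; rfl
    · exact absurd hb hb'
  · intro h
    by_cases hl : corner v (lowerSide k) ∈ K
    · refine ⟨⟨_, hl, Or.inl rfl⟩, _, fun hu => ?_, Or.inr rfl⟩
      rw [h1.2 hl, h2.2 hu] at h
      exact absurd h (by decide)
    · refine ⟨⟨_, ?_, Or.inr rfl⟩, _, hl, Or.inl rfl⟩
      by_contra hu
      rw [Bool.eq_false_iff.2 fun h => hl (h1.1 h), Bool.eq_false_iff.2 fun h => hu (h2.1 h)] at h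
      exact absurd h (by decide)

/-- Add to a set of squares its neighbours in `M`. -/
def linkStep (M T : ℕ) : ℕ :=
  (List.finRange 12).foldl (fun acc (k : Fin 12) => if T.testBit k then acc ||| (neighbourMask k &&& M) else acc) T

theorem testBit_linkStep {M T : ℕ} {l : Fin 12} (h : (linkStep M T).testBit l) :
    T.testBit l ∨ ∃ k : Fin 12, T.testBit k ∧ (neighbourMask k).testBit l ∧ M.testBit l := by
  have key : ∀ (L : List (Fin 12)) (a : ℕ), (L.foldl (fun acc (k : Fin 12) =>
      if T.testBit k then acc ||| (neighbourMask k &&& M) else acc) a).testBit l →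
      a.testBit l ∨ ∃ k : Fin 12, T.testBit k ∧ (neighbourMask k).testBit l ∧ M.testBit l := by
    intro L
    induction L with
    | nil => exact fun a h => Or.inl h
    | cons k L ih =>
      intro a h
      rcases ih _ h with h | h
      · simp only at h
        split_ifs at h with hk
        · rw [Nat.testBit_or, Nat.testBit_and, Bool.or_eq_true, Bool.and_eq_true] at h
          rcases h with h | h
          exacts [Or.inl h, Or.inr ⟨k, hk, h⟩]
        · exact Or.inl h
      · exact Or.inr h
  exact key _ _ h

/-- The set of boundary squares at a vertex, as a bit mask. -/
def mixedMask (o : (Fin 3 → Bool) → Bool) : ℕ := Nat.ofBits (mixed o)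

theorem testBit_mixedMask (o : (Fin 3 → Bool) → Bool) (k : Fin 12) :
    (mixedMask o).testBit k = mixed o k := by
  rw [mixedMask, Nat.testBit_ofBits_lt _ _ k.2]

/-- The occupation pattern of the eight cubes at a vertex between two levels of perpendicular
blocks: `r` and `s` tell which boxes of the two levels are occupied, `a` and `b` which boxes
exist. -/
def pattern (e a₀ a₁ b₀ b₁ r₀ r₁ s₀ s₁ : Bool) (t : Fin 3 → Bool) : Bool :=
  if t 2 = e then cond (t 0) a₁ a₀ && cond (t 1) r₁ r₀ else cond (t 1) b₁ b₀ && cond (t 0) s₁ s₀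

/-- The patterns at the vertices of a stack of blocks. -/
def IsStackPattern (o : (Fin 3 → Bool) → Bool) : Prop :=
  ∃ e a₀ a₁ b₀ b₁ r₀ r₁ s₀ s₁ : Bool, (s₀ → a₀) ∧ (s₁ → a₁) ∧ (r₀ → b₀) ∧ (r₁ → b₁) ∧
    o = pattern e a₀ a₁ b₀ b₁ r₀ r₁ s₀ s₁

/-- A flood fill from the square with the highest index reaches all boundary squares at the vertex.
Six rounds are ample: each of the six edges at a vertex lies on at most two boundary squares and
each square uses two of these edges, so there are at most six squares. -/
theorem linkStep_pattern : ∀ e a₀ a₁ b₀ b₁ r₀ r₁ s₀ s₁ : Bool, (s₀ → a₀) → (s₁ → a₁) → (r₀ → b₀) →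
    (r₁ → b₁) → (fun M => M ≠ 0 → M.testBit M.log2 ∧ (linkStep M)^[6] (2 ^ M.log2) &&& M = M)
      (mixedMask (pattern e a₀ a₁ b₀ b₁ r₀ r₁ s₀ s₁)) := by
  decide +kernel

/-- Around an edge, filled and empty cubes alternate 0, 2 or 4 times, and 4 means a checkerboard. At
a vertical edge the occupation of a level is a product, which is never a checkerboard. At a
horizontal edge the two cubes of one level belong to the same box; if one of them is filled and the
other empty, the latter is outside the `n × n` square, so by the implications the cube of the other
level next to it is empty as well. -/
theorem card_mixed_pattern : ∀ e a₀ a₁ b₀ b₁ r₀ r₁ s₀ s₁ : Bool, (s₀ → a₀) → (s₁ → a₁) →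
    (r₀ → b₀) → (r₁ → b₁) → ∀ j, (fun t => t ≠ 0 → t = 2) (Finset.univ.filter fun k =>
      mixed (pattern e a₀ a₁ b₀ b₁ r₀ r₁ s₀ s₁) k = true ∧
        IsFace (edgeOffset j) (squareOffset k)).card := by
  decide +kernel

theorem reflTransGen_linkAdj {v : Cell} (hv : dim v = 0) {K : Set (Fin 3 → ℤ)}
    {o : (Fin 3 → Bool) → Bool} (ho : ∀ s, o s = true ↔ corner v s ∈ K) (hs : IsStackPattern o)
    {f g : Cell} (hf : f ∈ boundarySquares K ∧ IsFace v f)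
    (hg : g ∈ boundarySquares K ∧ IsFace v g) : Relation.ReflTransGen (LinkAdj K v) f g := by
  set M := mixedMask o with hM
  have hMiff : ∀ k : Fin 12, M.testBit k = true ↔ v + squareOffset k ∈ boundarySquares K := by
    intro k
    rw [add_squareOffset_mem_iff hv ho, testBit_mixedMask]
  have hface : ∀ k, IsFace v (v + squareOffset k) := by
    intro k
    have := (isFace_add_iff hv 0 (squareOffset k)).2 (isFace_zero_squareOffset k)
    rwa [add_zero] at this
  have hsymm : Std.Symm (LinkAdj K v) := ⟨by
    rintro a b ⟨ha, hb, e, he, hve, hea, heb⟩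
    exact ⟨hb, ha, e, he, hve, heb, hea⟩⟩
  have hadj : ∀ k l : Fin 12, M.testBit k → M.testBit l → (neighbourMask k).testBit l →
      LinkAdj K v (v + squareOffset k) (v + squareOffset l) := by
    intro k l hk hl hkl
    obtain ⟨j, hjk, hjl⟩ := exists_common_edge k l hkl
    refine ⟨⟨(hMiff k).1 hk, hface k⟩, ⟨(hMiff l).1 hl, hface l⟩, v + edgeOffset j, ?_, ?_, ?_, ?_⟩
    · rw [dim_add hv, dim_edgeOffset]
    · have := (isFace_add_iff hv 0 (edgeOffset j)).2 (isFace_zero_edgeOffset j)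
      rwa [add_zero] at this
    · rwa [isFace_add_iff hv]
    · rwa [isFace_add_iff hv]
  obtain ⟨k, rfl⟩ := exists_eq_add_squareOffset hv hf.1.1 hf.2
  obtain ⟨l, rfl⟩ := exists_eq_add_squareOffset hv hg.1.1 hg.2
  have hkM := (hMiff k).2 hf.1
  have hlM := (hMiff l).2 hg.1
  have hM0 : M ≠ 0 := by
    intro h
    rw [h] at hkM
    simp at hkM
  obtain ⟨hroot, hall⟩ : M.testBit M.log2 ∧ (linkStep M)^[6] (2 ^ M.log2) &&& M = M := by
    obtain ⟨e, a₀, a₁, b₀, b₁, r₀, r₁, s₀, s₁, h1, h2, h3, h4, rfl⟩ := hs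
    exact linkStep_pattern e a₀ a₁ b₀ b₁ r₀ r₁ s₀ s₁ h1 h2 h3 h4 hM0
  have hlt : M.log2 < 12 := by
    rw [Nat.log2_lt hM0]
    exact Nat.ofBits_lt_two_pow _
  obtain ⟨r, hr⟩ : ∃ r : Fin 12, (r : ℕ) = M.log2 := ⟨⟨_, hlt⟩, rfl⟩
  rw [← hr] at hroot hall
  -- Soundness of the flood fill: every bit it sets is a boundary square joined to the root `r` by a
  -- chain of adjacencies.
  have hreach : ∀ m : ℕ, ∀ q : Fin 12, ((linkStep M)^[m] (2 ^ (r : ℕ))).testBit q → M.testBit q ∧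
      Relation.ReflTransGen (LinkAdj K v) (v + squareOffset r) (v + squareOffset q) := by
    intro m
    induction m with
    | zero =>
      intro q hq
      rw [Function.iterate_zero, id, Nat.testBit_two_pow, decide_eq_true_iff] at hq
      rw [← Fin.ext hq]
      exact ⟨hroot, .refl⟩
    | succ m ih =>
      intro q hq
      rw [Function.iterate_succ_apply'] at hq
      rcases testBit_linkStep hq with h | ⟨p, hp, hpq, hqM⟩
      · exact ih q h
      · obtain ⟨hpM, hrp⟩ := ih p hp
        exact ⟨hqM, hrp.tail (hadj p q hpM hqM hpq)⟩
  have hmem : ∀ q : Fin 12, M.testBit q → ((linkStep M)^[6] (2 ^ (r : ℕ))).testBit q := by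
    intro q hq
    rw [← hall, Nat.testBit_and, Bool.and_eq_true] at hq
    exact hq.1
  exact (Std.Symm.symm _ _ (hreach 6 k (hmem k hkM)).2).trans (hreach 6 l (hmem l hlM)).2

theorem ncard_squares_of_edge {v : Cell} (hv : dim v = 0) {K : Set (Fin 3 → ℤ)}
    {o : (Fin 3 → Bool) → Bool} (ho : ∀ s, o s = true ↔ corner v s ∈ K) (hs : IsStackPattern o)
    (j : Fin 6) (hb : IsBoundary K (v + edgeOffset j)) :
    {w | w ∈ boundarySquares K ∧ IsFace (v + edgeOffset j) w}.ncard = 2 := by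
  set F := Finset.univ.filter fun k => mixed o k = true ∧ IsFace (edgeOffset j) (squareOffset k)
    with hF
  have hvj : IsFace v (v + edgeOffset j) := by
    have := (isFace_add_iff hv 0 (edgeOffset j)).2 (isFace_zero_edgeOffset j)
    rwa [add_zero] at this
  have heq : {w | w ∈ boundarySquares K ∧ IsFace (v + edgeOffset j) w} =
      (fun k => v + squareOffset k) '' (F : Set (Fin 12)) := by
    ext w
    constructor
    · rintro ⟨hw, hjw⟩
      obtain ⟨k, rfl⟩ := exists_eq_add_squareOffset hv hw.1 (hvj.trans hjw)
      refine ⟨k, ?_, rfl⟩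
      rw [isFace_add_iff hv] at hjw
      simp [hF, hjw, ← add_squareOffset_mem_iff hv ho, hw]
    · rintro ⟨k, hk, rfl⟩
      simp only [hF, Finset.coe_filter, Finset.mem_univ, true_and, Set.mem_ofPred_eq] at hk
      exact ⟨(add_squareOffset_mem_iff hv ho k).2 hk.1, (isFace_add_iff hv _ _).2 hk.2⟩
  have hinj : Function.Injective fun k => v + squareOffset k :=
    (add_right_injective v).comp squareOffset_injective
  rw [heq, Set.ncard_image_of_injective _ hinj, Set.ncard_coe_finset]
  have hne : F.card ≠ 0 := by
    obtain ⟨w, hw, hjw⟩ := hb.exists_square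
    intro h0
    rw [Finset.card_eq_zero] at h0
    have : w ∈ (fun k => v + squareOffset k) '' (F : Set (Fin 12)) := by
      rw [← heq]
      exact ⟨hw, hjw⟩
    simp [h0] at this
  obtain ⟨e, a₀, a₁, b₀, b₁, r₀, r₁, s₀, s₁, h1, h2, h3, h4, rfl⟩ := hs
  exact card_mixed_pattern e a₀ a₁ b₀ b₁ r₀ r₁ s₀ s₁ h1 h2 h3 h4 j hne

/-- The lower corners of the cubes filled by a stack of blocks of length `n`, where `L i j` means
that box `j` of level `i` holds a block. -/
def stackCubes (n : ℕ) (L : ℤ → ℤ → Prop) : Set (Fin 3 → ℤ) :=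
  {b | if b 2 % 2 = 0 then (0 ≤ b 0 ∧ b 0 < n) ∧ L (b 2) (b 1)
    else (0 ≤ b 1 ∧ b 1 < n) ∧ L (b 2) (b 0)}

theorem mem_stackCubes_of_even {n : ℕ} {L : ℤ → ℤ → Prop} {b : Fin 3 → ℤ} (hb : b 2 % 2 = 0) :
    b ∈ stackCubes n L ↔ (0 ≤ b 0 ∧ b 0 < n) ∧ L (b 2) (b 1) := by
  rw [stackCubes, Set.mem_ofPred_eq, if_pos hb]

theorem mem_stackCubes_of_odd {n : ℕ} {L : ℤ → ℤ → Prop} {b : Fin 3 → ℤ} (hb : b 2 % 2 ≠ 0) :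
    b ∈ stackCubes n L ↔ (0 ≤ b 1 ∧ b 1 < n) ∧ L (b 2) (b 0) := by
  rw [stackCubes, Set.mem_ofPred_eq, if_neg hb]

-- Of the two levels meeting at the height of `v` one is even and one is odd; `e` records whether
-- the even one is above. The implications required of a pattern say that an occupied box index lies
-- in `0, …, n - 1`.
open Classical in
theorem exists_stackPattern {n : ℕ} {L : ℤ → ℤ → Prop} (hL : ∀ i j, L i j → 0 ≤ j ∧ j < n)
    (v : Cell) :
    ∃ o, IsStackPattern o ∧ ∀ s, o s = true ↔ corner v s ∈ stackCubes n L := by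
  obtain ⟨e, i, i', he⟩ : ∃ (e : Bool) (i i' : ℤ), ∀ t : Bool,
      (if t = e then v 2 / 2 - cond t 0 1 = i ∧ i % 2 = 0
        else v 2 / 2 - cond t 0 1 = i' ∧ i' % 2 ≠ 0) := by
    rcases Int.emod_two_eq_zero_or_one (v 2 / 2) with h | h
    · refine ⟨true, v 2 / 2, v 2 / 2 - 1, ?_⟩
      rintro (_ | _) <;> simp <;> omega
    · refine ⟨false, v 2 / 2 - 1, v 2 / 2, ?_⟩
      rintro (_ | _) <;> simp <;> omega
  refine ⟨_, ⟨e, decide (0 ≤ v 0 / 2 - 1 ∧ v 0 / 2 - 1 < n), decide (0 ≤ v 0 / 2 ∧ v 0 / 2 < n),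
    decide (0 ≤ v 1 / 2 - 1 ∧ v 1 / 2 - 1 < n), decide (0 ≤ v 1 / 2 ∧ v 1 / 2 < n),
    decide (L i (v 1 / 2 - 1)), decide (L i (v 1 / 2)), decide (L i' (v 0 / 2 - 1)),
    decide (L i' (v 0 / 2)), ?_, ?_, ?_, ?_, rfl⟩, ?_⟩
  · exact fun h => decide_eq_true (hL _ _ (of_decide_eq_true h))
  · exact fun h => decide_eq_true (hL _ _ (of_decide_eq_true h))
  · exact fun h => decide_eq_true (hL _ _ (of_decide_eq_true h))
  · exact fun h => decide_eq_true (hL _ _ (of_decide_eq_true h))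
  · intro s
    have h := he (s 2)
    by_cases hs : s 2 = e
    · rw [if_pos hs] at h
      have hi : corner v s 2 = i := h.1
      rw [mem_stackCubes_of_even (by rw [hi]; exact h.2), hi, pattern, if_pos hs]
      rcases h0 : s 0 <;> rcases h1 : s 1 <;> simp [corner, h0, h1]
    · rw [if_neg hs] at h
      have hi : corner v s 2 = i' := h.1
      rw [mem_stackCubes_of_odd (by rw [hi]; exact h.2), hi, pattern, if_neg hs]
      rcases h0 : s 0 <;> rcases h1 : s 1 <;> simp [corner, h0, h1]

/-- The boundary of a stack of blocks is a closed surface. -/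
theorem isClosedSurface_stack {c : Space} (hc : ∀ d, 0 < c d) {n : ℕ} {L : ℤ → ℤ → Prop}
    (hL : ∀ i j, L i j → 0 ≤ j ∧ j < n) (hK : (stackCubes n L).Finite) :
    (boundaryPolyhedron c hc (stackCubes n L) hK).IsClosedSurface := by
  refine isClosedSurface_boundaryPolyhedron hc hK ?_ ?_
  · intro z hz hb
    -- Each edge is viewed from its lower end point, so only the positive offsets 1, 3 and 5 occur.
    obtain ⟨v, j, hv, rfl⟩ : ∃ v j, dim v = 0 ∧ z = v + edgeOffset j := by
      rcases (dim_eq_one_iff z).1 hz with h | h | h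
      · refine ⟨![z 0 - 1, z 1, z 2], 1, ?_, ?_⟩
        · simp [dim_eq]; omega
        · funext d; fin_cases d <;> simp [edgeOffset]
      · refine ⟨![z 0, z 1 - 1, z 2], 3, ?_, ?_⟩
        · simp [dim_eq]; omega
        · funext d; fin_cases d <;> simp [edgeOffset]
      · refine ⟨![z 0, z 1, z 2 - 1], 5, ?_, ?_⟩
        · simp [dim_eq]; omega
        · funext d; fin_cases d <;> simp [edgeOffset]
    obtain ⟨o, hs, ho⟩ := exists_stackPattern hL v
    exact ncard_squares_of_edge hv ho hs j hb
  · intro v hv f g hf hg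
    obtain ⟨o, hs, ho⟩ := exists_stackPattern hL v
    exact reflTransGen_linkAdj hv ho hs hf hg

/-! ### Connectedness of the boundary of a stack -/

/-- Two boundary cells are linked if they are joined by a chain of incident boundary cells. -/
def Linked (K : Set (Fin 3 → ℤ)) : Cell → Cell → Prop :=
  Relation.ReflTransGen fun a b => IsBoundary K a ∧ IsBoundary K b ∧ (IsFace a b ∨ IsFace b a)

theorem Linked.trans {K : Set (Fin 3 → ℤ)} {f g h : Cell} (h₁ : Linked K f g)
    (h₂ : Linked K g h) : Linked K f h :=
  Relation.ReflTransGen.trans h₁ h₂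

theorem Linked.symm {K : Set (Fin 3 → ℤ)} {f g : Cell} (h : Linked K f g) : Linked K g f := by
  have : Std.Symm fun a b => IsBoundary K a ∧ IsBoundary K b ∧ (IsFace a b ∨ IsFace b a) :=
    ⟨fun a b ⟨ha, hb, h⟩ => ⟨hb, ha, h.symm⟩⟩
  exact Std.Symm.symm (r := Relation.ReflTransGen _) _ _ h

theorem linked_of_path {K : Set (Fin 3 → ℤ)} (f : ℤ → Cell) {p q : ℤ} (hpq : p ≤ q)
    (hb : ∀ t, p ≤ t → t ≤ q → IsBoundary K (f t))
    (hf : ∀ t, IsFace (f t) (f (t + 1)) ∨ IsFace (f (t + 1)) (f t)) : Linked K (f p) (f q) := by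
  induction q, hpq using Int.leInduction with
  | base => exact .refl
  | succ q hpq ih =>
    refine (ih fun t h1 h2 => hb t h1 (by omega)).trans (Relation.ReflTransGen.single ?_)
    exact ⟨hb q hpq (by omega), hb (q + 1) (by omega) le_rfl, hf q⟩

/-- The cell with coordinate `a` along and coordinate `b` across the blocks of level `i`, and with
vertical coordinate `z`. -/
def levelCell (i a b z : ℤ) : Cell := if i % 2 = 0 then ![a, b, z] else ![b, a, z]

theorem levelCell_of_even {i : ℤ} (hi : i % 2 = 0) (a b z : ℤ) : levelCell i a b z = ![a, b, z] :=
  if_pos hi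

theorem levelCell_of_odd {i : ℤ} (hi : i % 2 ≠ 0) (a b z : ℤ) : levelCell i a b z = ![b, a, z] :=
  if_neg hi

theorem levelCell_add_one (i a b z : ℤ) : levelCell (i + 1) a b z = levelCell i b a z := by
  by_cases h : i % 2 = 0
  · rw [levelCell_of_even h, levelCell_of_odd (by omega)]
  · rw [levelCell_of_odd h, levelCell_of_even (by omega)]

theorem exists_eq_levelCell (i : ℤ) (z : Cell) : ∃ a b, z = levelCell i a b (z 2) := by
  by_cases h : i % 2 = 0
  · refine ⟨z 0, z 1, ?_⟩
    rw [levelCell_of_even h]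
    funext d
    fin_cases d <;> rfl
  · refine ⟨z 1, z 0, ?_⟩
    rw [levelCell_of_odd h]
    funext d
    fin_cases d <;> rfl

theorem isFace_levelCell_iff {i a b z a' b' z' : ℤ} :
    IsFace (levelCell i a b z) (levelCell i a' b' z') ↔
      (a' / 2 ≤ a / 2 ∧ (a + 1) / 2 ≤ (a' + 1) / 2) ∧
      (b' / 2 ≤ b / 2 ∧ (b + 1) / 2 ≤ (b' + 1) / 2) ∧
      (z' / 2 ≤ z / 2 ∧ (z + 1) / 2 ≤ (z' + 1) / 2) := by
  by_cases h : i % 2 = 0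
  · rw [levelCell_of_even h, levelCell_of_even h, isFace_iff]
    rfl
  · rw [levelCell_of_odd h, levelCell_of_odd h, isFace_iff]
    exact and_left_comm

theorem over_levelCell_iff {i a b z a' b' z' : ℤ} :
    Over (levelCell i a b z) (levelCell i a' b' z') ↔
      ((a - 1) / 2 ≤ a' ∧ a' ≤ a / 2) ∧ ((b - 1) / 2 ≤ b' ∧ b' ≤ b / 2) ∧
      ((z - 1) / 2 ≤ z' ∧ z' ≤ z / 2) := by
  by_cases h : i % 2 = 0
  · rw [levelCell_of_even h, levelCell_of_even h, Over, Fin.forall_fin_succ, Fin.forall_fin_two]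
    rfl
  · rw [levelCell_of_odd h, levelCell_of_odd h, Over, Fin.forall_fin_succ, Fin.forall_fin_two]
    exact and_left_comm

theorem dim_levelCell (i a b z : ℤ) : dim (levelCell i a b z) = a % 2 + b % 2 + z % 2 := by
  by_cases h : i % 2 = 0
  · rw [levelCell_of_even h, dim_eq]
    rfl
  · rw [levelCell_of_odd h, dim_eq]
    simp only [Matrix.cons_val]
    ring

theorem levelCell_mem_iff {n : ℕ} {L : ℤ → ℤ → Prop} {i a b : ℤ} :
    levelCell i a b i ∈ stackCubes n L ↔ (0 ≤ a ∧ a < n) ∧ L i b := by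
  by_cases h : i % 2 = 0
  · rw [levelCell_of_even h, mem_stackCubes_of_even (by exact h)]
    rfl
  · rw [levelCell_of_odd h, mem_stackCubes_of_odd (by exact h)]
    rfl

section Stack

variable {n : ℕ} {x : ℤ} {L : ℤ → ℤ → Prop}

theorem isBoundary_wall (hn : 0 < n) {i j : ℤ} (hw : ¬ (L i (j - 1) ↔ L i j)) {a z : ℤ}
    (ha : 0 ≤ a ∧ a ≤ 2 * n) (hz : 2 * i ≤ z ∧ z ≤ 2 * i + 2) :
    IsBoundary (stackCubes n L) (levelCell i a (2 * j) z) := by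
  obtain ⟨u, hu, hu'⟩ : ∃ u : ℤ, ((a - 1) / 2 ≤ u ∧ u ≤ a / 2) ∧ (0 ≤ u ∧ u < n) := by
    -- At the far end of the block rounding down would give the nonexistent cube `n`, so the last
    -- cube is used.
    by_cases h : a = 2 * n
    · exact ⟨n - 1, by omega⟩
    · exact ⟨a / 2, by omega⟩
  have hover : ∀ t, (t = j - 1 ∨ t = j) →
      Over (levelCell i a (2 * j) z) (levelCell i u t i) := by
    intro t ht
    rw [over_levelCell_iff]
    omega
  have hmem : ∀ t, levelCell i u t i ∈ stackCubes n L ↔ L i t := by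
    intro t
    rw [levelCell_mem_iff]
    exact and_iff_right hu'
  by_cases h : L i j
  · have h' : ¬ L i (j - 1) := fun h' => hw ⟨fun _ => h, fun _ => h'⟩
    exact ⟨⟨_, (hmem _).2 h, hover _ (Or.inr rfl)⟩, _, fun hK => h' ((hmem _).1 hK),
      hover _ (Or.inl rfl)⟩
  · have h' : L i (j - 1) := by
      by_contra h'
      exact hw ⟨fun h'' => absurd h'' h', fun h'' => absurd h'' h⟩
    exact ⟨⟨_, (hmem _).2 h', hover _ (Or.inl rfl)⟩, _, fun hK => h ((hmem _).1 hK),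
      hover _ (Or.inr rfl)⟩

theorem linked_wall (hn : 0 < n) {i j : ℤ} (hw : ¬ (L i (j - 1) ↔ L i j)) {a z a' z' : ℤ}
    (ha : 0 ≤ a ∧ a ≤ 2 * n) (hz : 2 * i ≤ z ∧ z ≤ 2 * i + 2)
    (ha' : 0 ≤ a' ∧ a' ≤ 2 * n) (hz' : 2 * i ≤ z' ∧ z' ≤ 2 * i + 2) :
    Linked (stackCubes n L) (levelCell i a (2 * j) z) (levelCell i a' (2 * j) z') := by
  have key : ∀ {a z : ℤ}, (0 ≤ a ∧ a ≤ 2 * n) → (2 * i ≤ z ∧ z ≤ 2 * i + 2) →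
      Linked (stackCubes n L) (levelCell i 0 (2 * j) (2 * i)) (levelCell i a (2 * j) z) := by
    intro a z ha hz
    refine Linked.trans (linked_of_path (fun t => levelCell i t (2 * j) (2 * i)) ha.1 ?_ ?_)
      (linked_of_path (fun t => levelCell i a (2 * j) t) hz.1 ?_ ?_)
    · exact fun t h0 ht => isBoundary_wall hn hw (by omega) (by omega)
    · intro t
      rw [isFace_levelCell_iff, isFace_levelCell_iff]
      omega
    · exact fun t h0 ht => isBoundary_wall hn hw ha (by omega)
    · intro t
      rw [isFace_levelCell_iff, isFace_levelCell_iff]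
      omega
  exact (key ha hz).symm.trans (key ha' hz')

theorem exists_end_of_run (hL : ∀ i j, L i j → 0 ≤ j ∧ j < n) {i j : ℤ} (hj : L i j) :
    ∃ j', j < j' ∧ (∀ t, j ≤ t → t < j' → L i t) ∧ ¬ L i j' := by
  classical
  obtain ⟨j', ⟨h1, h2⟩, h3⟩ := Int.exists_least_of_bdd (P := fun t => j < t ∧ ¬ L i t)
    ⟨j, fun t ht => ht.1.le⟩ ⟨n, (hL i j hj).2, fun h => by have := hL i _ h; omega⟩
  refine ⟨j', h1, fun t ht ht' => ?_, h2⟩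
  by_contra h
  rcases ht.eq_or_lt with rfl | ht
  · exact h hj
  · have := h3 t ⟨ht, h⟩
    omega

/-- Slide a cell across the blocks to the end of its run. The cells passed stay on the boundary
because filled cubes of the run are on one side and a whole row of empty cubes, given by `hfree`, is
on the other. -/
theorem linked_run (hL : ∀ i j, L i j → 0 ≤ j ∧ j < n) {i j : ℤ} (hj : L i j)
    {a z : ℤ} (hz : 2 * i ≤ z ∧ z ≤ 2 * i + 2) {u : ℤ}
    (hu : 0 ≤ u ∧ u < n) (hau : (a - 1) / 2 ≤ u ∧ u ≤ a / 2) {u' i' : ℤ}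
    (hau' : (a - 1) / 2 ≤ u' ∧ u' ≤ a / 2) (hzi : (z - 1) / 2 ≤ i' ∧ i' ≤ z / 2)
    (hfree : ∀ t, levelCell i u' t i' ∉ stackCubes n L) :
    ∃ j', ¬ (L i (j' - 1) ↔ L i j') ∧
      Linked (stackCubes n L) (levelCell i a (2 * j + 1) z) (levelCell i a (2 * j') z) := by
  obtain ⟨j', hlt, hrun, hend⟩ := exists_end_of_run hL hj
  refine ⟨j', fun h => hend (h.1 (hrun _ (by omega) (by omega))), ?_⟩
  refine linked_of_path (fun t => levelCell i a t z) (by omega) ?_ ?_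
  · intro t h1 h2
    refine ⟨⟨levelCell i u ((t - 1) / 2) i, ?_, ?_⟩, levelCell i u' ((t - 1) / 2) i', hfree _, ?_⟩
    · rw [levelCell_mem_iff]
      exact ⟨hu, hrun _ (by omega) (by omega)⟩
    · rw [over_levelCell_iff]
      omega
    · rw [over_levelCell_iff]
      omega
  · intro t
    rw [isFace_levelCell_iff, isFace_levelCell_iff]
    omega

/-- A boundary square is a piece of a wall, an end face of a block, or horizontal. For an end face
the row of cubes beyond the end of the blocks is empty. For a horizontal square the neighbouring
level runs crosswise, so the empty cube there belongs to an empty box, which is a whole row. -/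
theorem linked_square_wall (hL : ∀ i j, L i j → 0 ≤ j ∧ j < n) {w : Cell}
    (hw : w ∈ boundarySquares (stackCubes n L)) :
    ∃ i j a z, (∃ t, L i t) ∧ ¬ (L i (j - 1) ↔ L i j) ∧ (0 ≤ a ∧ a ≤ 2 * (n : ℤ)) ∧
      (2 * i ≤ z ∧ z ≤ 2 * i + 2) ∧
      Linked (stackCubes n L) w (levelCell i a (2 * j) z) := by
  obtain ⟨hdim, ⟨b, hb, hwb⟩, b', hb', hwb'⟩ := hw
  set i := b 2 with hi
  obtain ⟨a, y, hay⟩ := exists_eq_levelCell i w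
  obtain ⟨u, j, huj⟩ := exists_eq_levelCell i b
  obtain ⟨u', j', huj'⟩ := exists_eq_levelCell i b'
  generalize hz : w 2 = z at hay
  generalize hi' : b' 2 = i' at huj'
  rw [← hi] at huj
  subst hay
  rw [huj, levelCell_mem_iff] at hb
  rw [huj, over_levelCell_iff] at hwb
  rw [huj'] at hb'
  rw [huj', over_levelCell_iff] at hwb'
  rw [dim_levelCell] at hdim
  have hjn := hL i j hb.2
  obtain ⟨hu, hLj⟩ := hb
  have hcase : (y % 2 = 0 ∧ a % 2 = 1 ∧ z % 2 = 1) ∨ (y % 2 = 1 ∧ a % 2 = 0 ∧ z % 2 = 1) ∨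
      (y % 2 = 1 ∧ a % 2 = 1 ∧ z % 2 = 0) := by omega
  have ha : 0 ≤ a ∧ a ≤ 2 * (n : ℤ) := by omega
  have hzz : 2 * i ≤ z ∧ z ≤ 2 * i + 2 := by omega
  have hrun : y = 2 * j + 1 → (∀ t, levelCell i u' t i' ∉ stackCubes n L) →
      ∃ i j a' z', (∃ t, L i t) ∧ ¬ (L i (j - 1) ↔ L i j) ∧ (0 ≤ a' ∧ a' ≤ 2 * (n : ℤ)) ∧
      (2 * i ≤ z' ∧ z' ≤ 2 * i + 2) ∧
      Linked (stackCubes n L) (levelCell (b 2) a y z) (levelCell i a' (2 * j) z') := by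
    rintro rfl hfree
    obtain ⟨k, hk, hlink⟩ := linked_run hL hLj hzz hu hwb.1 hwb'.1 hwb'.2.2 hfree
    exact ⟨i, k, a, z, ⟨j, hLj⟩, hk, ha, hzz, hlink⟩
  rcases hcase with ⟨hy, h1, h2⟩ | ⟨hy, h1, h2⟩ | ⟨hy, h1, h2⟩
  · have hi'i : i' = i := by omega
    rw [hi'i, levelCell_mem_iff] at hb'
    have hj' : ¬ L i j' := fun h => hb' ⟨by omega, h⟩
    have hjj : j ≠ j' := by rintro rfl; exact hj' hLj
    refine ⟨i, y / 2, a, z, ⟨j, hLj⟩, ?_, ha, hzz, ?_⟩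
    · rcases (by omega : (j = y / 2 - 1 ∧ j' = y / 2) ∨ (j' = y / 2 - 1 ∧ j = y / 2)) with
        ⟨rfl, rfl⟩ | ⟨rfl, rfl⟩ <;> tauto
    · rw [show 2 * (y / 2) = y by omega]
      exact .refl
  · refine hrun (by omega) fun t ht => hb' ?_
    have hi'i : i' = i := by omega
    rw [hi'i, levelCell_mem_iff] at ht ⊢
    exact ⟨ht.1, by rwa [show j' = j by omega]⟩
  · refine hrun (by omega) fun t ht => hb' ?_
    have hne : i' ≠ i := by
      rintro h
      rw [h, levelCell_mem_iff] at hb'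
      refine hb' ⟨by omega, by rwa [show j' = j by omega]⟩
    -- Passing to an adjacent level exchanges the directions along and across the blocks.
    have hswap : ∀ s, levelCell i u' s i' = levelCell i' s u' i' := by
      intro s
      rcases (by omega : i' = i + 1 ∨ i = i' + 1) with h | h
      · rw [h, levelCell_add_one]
      · rw [h, levelCell_add_one]
    rw [hswap, levelCell_mem_iff] at ht ⊢
    exact ⟨by omega, ht.2⟩

/-- The boundary cells of a stack of at least two nonempty levels are linked to each other. -/
theorem linked_of_isBoundary (hn : 0 < n) (hx : 2 ≤ x)
    (hL : ∀ i j, L i j → (0 ≤ i ∧ i < x) ∧ 0 ≤ j ∧ j < n)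
    (hne : ∀ i, 0 ≤ i → i < x → ∃ j, L i j) {f g : Cell}
    (hf : IsBoundary (stackCubes n L) f) (hg : IsBoundary (stackCubes n L) g) :
    Linked (stackCubes n L) f g := by
  have hL' : ∀ i j, L i j → 0 ≤ j ∧ j < n := fun i j h => (hL i j h).2
  have hwall : ∀ i, 0 ≤ i → i < x → ∃ j, ¬ (L i (j - 1) ↔ L i j) := by
    intro i h0 h1
    obtain ⟨j, hj⟩ := hne i h0 h1
    obtain ⟨j', hlt, hrun, hend⟩ := exists_end_of_run hL' hj
    exact ⟨j', fun h => hend (h.1 (hrun _ (by omega) (by omega)))⟩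
  have hrange : ∀ {i j}, ¬ (L i (j - 1) ↔ L i j) → 0 ≤ j ∧ j ≤ n := by
    intro i j h
    by_contra hno
    refine h ⟨fun h => ?_, fun h => ?_⟩
    · have := hL' _ _ h
      omega
    · have := hL' _ _ h
      omega
  -- Walls of consecutive levels are perpendicular and both extend over the full length `n`, so they
  -- meet in a grid point of the interface.
  have hadj : ∀ {i j j'}, ¬ (L i (j - 1) ↔ L i j) → ¬ (L (i + 1) (j' - 1) ↔ L (i + 1) j') →
      Linked (stackCubes n L) (levelCell i 0 (2 * j) (2 * i))
        (levelCell (i + 1) 0 (2 * j') (2 * (i + 1))) := by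
    intro i j j' h h'
    have hj := hrange h
    have hj' := hrange h'
    have h1 := linked_wall (a := 0) (z := 2 * i) (a' := 2 * j') (z' := 2 * i + 2) hn h
      (by omega) (by omega) (by omega) (by omega)
    have h2 := linked_wall (a := 0) (z := 2 * (i + 1)) (a' := 2 * j) (z' := 2 * (i + 1)) hn h'
      (by omega) (by omega) (by omega) (by omega)
    rw [levelCell_add_one i (2 * j)] at h2
    rw [show 2 * (i + 1) = 2 * i + 2 by ring] at h2 ⊢
    exact h1.trans h2.symm
  obtain ⟨j₀, hj₀⟩ := hwall 0 (by omega) (by omega)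
  obtain ⟨j₁, hj₁⟩ := hwall 1 (by omega) (by omega)
  have hbase : ∀ i, 0 ≤ i → i < x → ∀ j, ¬ (L i (j - 1) ↔ L i j) →
      Linked (stackCubes n L) (levelCell 0 0 (2 * j₀) (2 * 0)) (levelCell i 0 (2 * j) (2 * i)) := by
    intro i h0
    induction i, h0 using Int.leInduction with
    | base =>
      intro _ j hj
      -- Parallel walls of the bottom level are joined through a wall of the next one, so a second
      -- nonempty level is essential.
      exact (hadj hj₀ hj₁).trans (hadj hj hj₁).symm
    | succ i h0 ih =>
      intro hix j hj
      obtain ⟨k, hk⟩ := hwall i h0 (by omega)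
      exact (ih (by omega) k hk).trans (hadj hk hj)
  have hall : ∀ f, IsBoundary (stackCubes n L) f →
      Linked (stackCubes n L) (levelCell 0 0 (2 * j₀) (2 * 0)) f := by
    intro f hf
    obtain ⟨w, hw, hfw⟩ := hf.exists_square
    obtain ⟨i, j, a, z, ⟨t, ht⟩, hj, ha, hz, hlink⟩ := linked_square_wall hL' hw
    have hi := (hL i t ht).1
    refine ((hbase i hi.1 hi.2 j hj).trans
      (linked_wall hn hj (by omega) (by omega) ha hz)).trans (hlink.symm.trans ?_)
    exact Relation.ReflTransGen.single ⟨hw.2, hf, Or.inr hfw⟩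
  exact (hall f hf).symm.trans (hall g hg)

theorem finite_stackCubes (hL : ∀ i j, L i j → (0 ≤ i ∧ i < x) ∧ 0 ≤ j ∧ j < n) :
    (stackCubes n L).Finite := by
  refine (Set.Finite.pi' fun _ : Fin 3 => Set.finite_Ico (0 : ℤ) (max x n)).subset ?_
  intro b hb
  have key : (0 ≤ b 0 ∧ b 0 < n) ∧ (0 ≤ b 1 ∧ b 1 < n) ∧ 0 ≤ b 2 ∧ b 2 < x := by
    by_cases h : b 2 % 2 = 0
    · rw [mem_stackCubes_of_even h] at hb
      exact ⟨hb.1, (hL _ _ hb.2).2, (hL _ _ hb.2).1⟩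
    · rw [mem_stackCubes_of_odd h] at hb
      exact ⟨(hL _ _ hb.2).2, hb.1, (hL _ _ hb.2).1⟩
  intro d
  rw [Set.mem_Ico, lt_max_iff]
  fin_cases d <;> simp <;> omega

theorem isConnected_frontier_stack {c : Space} (hc : ∀ d, 0 < c d) (hn : 0 < n) (hx : 2 ≤ x)
    (hL : ∀ i j, L i j → (0 ≤ i ∧ i < x) ∧ 0 ≤ j ∧ j < n)
    (hne : ∀ i, 0 ≤ i → i < x → ∃ j, L i j) :
    IsConnected (frontier (⋃ b ∈ stackCubes n L, cellSet c (cube b))) := by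
  refine isConnected_frontier hc (finite_stackCubes hL) ?_ fun f g hf hg =>
    linked_of_isBoundary hn hx hL hne hf hg
  obtain ⟨j, hj⟩ := hne 0 le_rfl (by omega)
  obtain ⟨j', hlt, hrun, hend⟩ := exists_end_of_run (fun i j h => (hL i j h).2) hj
  exact ⟨_, isBoundary_wall (a := 0) (z := 2 * 0) hn
    (fun h => hend (h.1 (hrun _ (by omega) (by omega)))) (by omega) (by omega)⟩

end Stack

/-! ### The Euler characteristic of the boundary of a stack -/

open Classical in
/-- The indicator of a proposition. -/
noncomputable def ind (p : Prop) : ℤ := if p then 1 else 0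

theorem ind_true {p : Prop} (h : p) : ind p = 1 := if_pos h

theorem ind_false {p : Prop} (h : ¬ p) : ind p = 0 := if_neg h

theorem ind_congr {p q : Prop} (h : p ↔ q) : ind p = ind q := by rw [propext h]

theorem ind_and (p q : Prop) : ind (p ∧ q) = ind p * ind q := by
  by_cases hp : p <;> by_cases hq : q <;> simp [ind, hp, hq]

theorem ind_or (p q : Prop) : ind (p ∨ q) = ind p + ind q - ind (p ∧ q) := by
  by_cases hp : p <;> by_cases hq : q <;> simp [ind, hp, hq]

theorem ind_and_not {p q : Prop} (h : q → p) : ind (p ∧ ¬ q) = ind p - ind q := by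
  by_cases hp : p <;> by_cases hq : q <;> simp [ind, hp, hq]
  exact hp (h hq)

/-- The parity sign of an integer. -/
def sign (a : ℤ) : ℤ := 1 - 2 * (a % 2)

/-- The alternating sum of `f` over `0, …, 2 * N`. -/
def altSum (N : ℕ) (f : ℤ → ℤ) : ℤ := ∑ k ∈ Finset.range (2 * N + 1), sign k * f k

theorem altSum_eq (N : ℕ) (f : ℤ → ℤ) : altSum N f =
    ∑ j ∈ Finset.range (N + 1), f (2 * j) - ∑ j ∈ Finset.range N, f (2 * j + 1) := by
  induction N with
  | zero => simp [altSum, sign]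
  | succ N ih =>
    have h : altSum (N + 1) f = altSum N f - f (2 * N + 1) + f (2 * (N + 1)) := by
      rw [altSum, show 2 * (N + 1) + 1 = 2 * N + 1 + 1 + 1 by ring, Finset.sum_range_succ,
        Finset.sum_range_succ, ← altSum]
      have h1 : sign ((2 * N + 1 : ℕ) : ℤ) = -1 := by rw [sign]; push_cast; omega
      have h2 : sign ((2 * N + 1 + 1 : ℕ) : ℤ) = 1 := by rw [sign]; push_cast; omega
      rw [h1, h2]
      push_cast
      ring_nf
    rw [h, ih, Finset.sum_range_succ _ (N + 1),
      Finset.sum_range_succ (fun j : ℕ => f (2 * j + 1)) N]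
    push_cast
    ring

theorem altSum_comm (M N : ℕ) (f : ℤ → ℤ → ℤ) :
    altSum M (fun a => altSum N fun b => f a b) = altSum N fun b => altSum M fun a => f a b := by
  simp only [altSum, Finset.mul_sum]
  rw [Finset.sum_comm]
  exact Finset.sum_congr rfl fun _ _ => Finset.sum_congr rfl fun _ _ => by ring

/-- Multiplicativity of the Euler characteristic on products, which reduces each horizontal slice to
one-dimensional counts. -/
theorem altSum_mul (M N : ℕ) (f g : ℤ → ℤ) :
    altSum M (fun a => altSum N fun b => f a * g b) = altSum M f * altSum N g := by
  simp only [altSum, Finset.mul_sum, Finset.sum_mul]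
  rw [Finset.sum_comm]
  exact Finset.sum_congr rfl fun _ _ => Finset.sum_congr rfl fun _ _ => by ring

theorem altSum_add (N : ℕ) (f g : ℤ → ℤ) :
    altSum N (fun a => f a + g a) = altSum N f + altSum N g := by
  simp only [altSum, mul_add, Finset.sum_add_distrib]

theorem altSum_sub (N : ℕ) (f g : ℤ → ℤ) :
    altSum N (fun a => f a - g a) = altSum N f - altSum N g := by
  simp only [altSum, mul_sub, Finset.sum_sub_distrib]

theorem ncard_eq_sum_ind {n X : ℕ} {P : Cell → Prop}
    (hP : ∀ z, P z → (0 ≤ z 0 ∧ z 0 ≤ 2 * n) ∧ (0 ≤ z 1 ∧ z 1 ≤ 2 * n) ∧ 0 ≤ z 2 ∧ z 2 ≤ 2 * X) :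
    ({z | P z}.ncard : ℤ) = ∑ c ∈ Finset.range (2 * X + 1), ∑ a ∈ Finset.range (2 * n + 1),
      ∑ b ∈ Finset.range (2 * n + 1), ind (P ![a, b, c]) := by
  classical
  set F := (Finset.range (2 * X + 1) ×ˢ Finset.range (2 * n + 1) ×ˢ Finset.range (2 * n + 1)).filter
    fun t : ℕ × ℕ × ℕ => P ![t.2.1, t.2.2, t.1] with hF
  have himg : {z | P z} = (fun t : ℕ × ℕ × ℕ => (![t.2.1, t.2.2, t.1] : Cell)) '' (F : Set _) := by
    ext z
    constructor
    · intro hz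
      have h := hP z hz
      have hz' : (![((z 0).toNat : ℤ), ((z 1).toNat : ℤ), ((z 2).toNat : ℤ)] : Cell) = z := by
        funext d
        fin_cases d <;> simp <;> omega
      refine ⟨((z 2).toNat, (z 0).toNat, (z 1).toNat), ?_, hz'⟩
      simp only [hF, Finset.coe_filter, Set.mem_ofPred_eq, Finset.mem_product, Finset.mem_range]
      refine ⟨by omega, ?_⟩
      rw [hz']
      exact hz
    · rintro ⟨t, ht, rfl⟩
      simp only [hF, Finset.coe_filter, Set.mem_ofPred_eq] at ht
      exact ht.2
  have hinj : Function.Injective fun t : ℕ × ℕ × ℕ => (![t.2.1, t.2.2, t.1] : Cell) := by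
    rintro ⟨a, b, c⟩ ⟨a', b', c'⟩ h
    have h0 := congrFun h 0
    have h1 := congrFun h 1
    have h2 := congrFun h 2
    simp at h0 h1 h2
    rw [h0, h1, h2]
  rw [himg, Set.ncard_image_of_injective _ hinj, Set.ncard_coe_finset, hF, Finset.card_filter,
    Finset.sum_product]
  push_cast
  refine Finset.sum_congr rfl fun c _ => ?_
  rw [Finset.sum_product]
  refine Finset.sum_congr rfl fun a _ => Finset.sum_congr rfl fun b _ => ?_
  simp only [ind]

theorem IsBoundary.dim_ne_three {K : Set (Fin 3 → ℤ)} {z : Cell} (h : IsBoundary K z) :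
    dim z ≠ 3 := by
  obtain ⟨w, hw, hzw⟩ := h.exists_square
  intro h3
  have := hzw.eq_of_dim_le (by rw [hw.1, h3]; norm_num)
  rw [this, hw.1] at h3
  omega

/-- The product of the three parity signs is `(-1) ^ dim`, three-dimensional cells are never on the
boundary, and all boundary cells lie in the box of summation. -/
theorem eulerChar_eq_altSum {n X : ℕ} {K : Set (Fin 3 → ℤ)}
    (hK : ∀ b ∈ K, (0 ≤ b 0 ∧ b 0 < n) ∧ (0 ≤ b 1 ∧ b 1 < n) ∧ 0 ≤ b 2 ∧ b 2 < X) :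
    ({z | dim z = 0 ∧ IsBoundary K z}.ncard : ℤ) - ({z | dim z = 1 ∧ IsBoundary K z}.ncard : ℤ)
      + ({z | dim z = 2 ∧ IsBoundary K z}.ncard : ℤ) =
    altSum X fun c => altSum n fun a => altSum n fun b => ind (IsBoundary K ![a, b, c]) := by
  have hbox : ∀ z, IsBoundary K z →
      (0 ≤ z 0 ∧ z 0 ≤ 2 * n) ∧ (0 ≤ z 1 ∧ z 1 ≤ 2 * n) ∧ 0 ≤ z 2 ∧ z 2 ≤ 2 * X := by
    rintro z ⟨⟨b, hb, hzb⟩, -⟩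
    have := hK b hb
    have := hzb 0
    have := hzb 1
    have := hzb 2
    omega
  rw [ncard_eq_sum_ind fun z hz => hbox z hz.2, ncard_eq_sum_ind fun z hz => hbox z hz.2,
    ncard_eq_sum_ind fun z hz => hbox z hz.2]
  simp only [altSum, Finset.mul_sum, ← Finset.sum_sub_distrib, ← Finset.sum_add_distrib]
  refine Finset.sum_congr rfl fun c _ => Finset.sum_congr rfl fun a _ =>
    Finset.sum_congr rfl fun b _ => ?_
  simp only [ind_and]
  by_cases hB : IsBoundary K ![a, b, c]
  · have h3 := hB.dim_ne_three
    rw [ind_true hB]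
    simp only [dim_eq, Matrix.cons_val, sign] at h3 ⊢
    rcases Int.emod_two_eq_zero_or_one a with ha | ha <;>
      rcases Int.emod_two_eq_zero_or_one b with hb | hb <;>
      rcases Int.emod_two_eq_zero_or_one c with hc | hc <;>
      simp [ha, hb, hc, ind] at h3 ⊢
  · rw [ind_false hB]
    ring

/-! ### Runs and one-dimensional Euler characteristics. -/

/-- Some interval of the line containing the cell `a` satisfies `P`. -/
def Touches (P : ℤ → Prop) (a : ℤ) : Prop := ∃ u, ((a - 1) / 2 ≤ u ∧ u ≤ a / 2) ∧ P u

/-- Every interval of the line containing the cell `a` satisfies `P`. -/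
def Inside (P : ℤ → Prop) (a : ℤ) : Prop := ∀ u, ((a - 1) / 2 ≤ u ∧ u ≤ a / 2) → P u

/-- The number of maximal runs of a subset `P` of `0, …, n - 1`. -/
noncomputable def runs (n : ℕ) (P : ℤ → Prop) : ℤ :=
  ∑ j ∈ Finset.range n, ind (P j) - ∑ j ∈ Finset.range (n + 1), ind (P j ∧ P (j - 1))

theorem touches_even {P : ℤ → Prop} {j : ℤ} : Touches P (2 * j) ↔ P j ∨ P (j - 1) := by
  constructor
  · rintro ⟨u, hu, hP⟩
    rcases (by omega : u = j ∨ u = j - 1) with rfl | rfl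
    exacts [Or.inl hP, Or.inr hP]
  · rintro (h | h)
    exacts [⟨_, by omega, h⟩, ⟨_, by omega, h⟩]

theorem touches_odd {P : ℤ → Prop} {j : ℤ} : Touches P (2 * j + 1) ↔ P j := by
  constructor
  · rintro ⟨u, hu, hP⟩
    rwa [show j = u by omega]
  · exact fun h => ⟨_, by omega, h⟩

theorem inside_even {P : ℤ → Prop} {j : ℤ} : Inside P (2 * j) ↔ P j ∧ P (j - 1) := by
  constructor
  · exact fun h => ⟨h _ (by omega), h _ (by omega)⟩
  · rintro ⟨h, h'⟩ u hu
    rcases (by omega : u = j ∨ u = j - 1) with rfl | rfl <;> assumption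

theorem inside_odd {P : ℤ → Prop} {j : ℤ} : Inside P (2 * j + 1) ↔ P j := by
  constructor
  · exact fun h => h _ (by omega)
  · intro h u hu
    rwa [show u = j by omega]

theorem Inside.touches {P : ℤ → Prop} {a : ℤ} (h : Inside P a) : Touches P a :=
  ⟨a / 2, by omega, h _ (by omega)⟩

/-- The cells in question form the closed union of the intervals in `P`: each run is a closed
segment, of Euler characteristic 1. -/
theorem altSum_touches {n : ℕ} {P : ℤ → Prop} (hP : ∀ j, P j → 0 ≤ j ∧ j < n) :
    altSum n (fun a => ind (Touches P a)) = runs n P := by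
  simp only [altSum_eq, touches_even, touches_odd, ind_or, Finset.sum_sub_distrib,
    Finset.sum_add_distrib, runs]
  have h1 : ∑ j ∈ Finset.range (n + 1), ind (P j) = ∑ j ∈ Finset.range n, ind (P j) := by
    rw [Finset.sum_range_succ, ind_false (fun h => by have := hP _ h; omega), add_zero]
  have h2 : ∑ j ∈ Finset.range (n + 1), ind (P (j - 1)) = ∑ j ∈ Finset.range n, ind (P j) := by
    rw [Finset.sum_range_succ', ind_false (fun h => by have := hP _ h; omega), add_zero]
    refine Finset.sum_congr rfl fun j _ => ?_
    push_cast
    rw [add_sub_cancel_right]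
  rw [h1, h2]
  ring

/-- These cells form the interior of that union: each run is an open segment, with one more interval
than points, and counts -1. -/
theorem altSum_inside {n : ℕ} {P : ℤ → Prop} :
    altSum n (fun a => ind (Inside P a)) = - runs n P := by
  simp only [altSum_eq, inside_even, inside_odd, runs]
  ring

theorem runs_interval {n : ℕ} {P : ℤ → Prop} {a b : ℤ} (ha : 0 ≤ a) (hab : a < b) (hb : b ≤ n)
    (hP : ∀ j, P j ↔ a ≤ j ∧ j < b) : runs n P = 1 := by
  have h1 : ∑ j ∈ Finset.range n, ind (P j) = ∑ j ∈ Finset.range (n + 1), ind (P j) := by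
    rw [Finset.sum_range_succ, ind_false (fun h => by have := (hP _).1 h; omega), add_zero]
  -- A term is nonzero only where a run starts, here at `a`.
  rw [runs, h1, ← Finset.sum_sub_distrib, Finset.sum_eq_single a.toNat]
  · rw [ind_true, ind_false, sub_zero]
    · rw [hP, hP]
      omega
    · rw [hP]
      omega
  · intro j _ hj
    rw [sub_eq_zero]
    refine ind_congr ?_
    rw [hP, hP]
    omega
  · intro h
    rw [Finset.mem_range] at h
    omega

theorem runs_empty {n : ℕ} {P : ℤ → Prop} (hP : ∀ j, ¬ P j) : runs n P = 0 := by
  simp [runs, ind_false (hP _), ind_and]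

theorem runs_of_separated {n : ℕ} {P : ℤ → Prop} (hP : ∀ j, P j → ¬ P (j - 1)) :
    runs n P = ∑ j ∈ Finset.range n, ind (P j) := by
  rw [runs, Finset.sum_eq_zero (s := Finset.range (n + 1)), sub_zero]
  exact fun j _ => ind_false fun h => hP _ h.1 h.2

/-- The range of summation is symmetric in the two horizontal axes, so they may be named after the
direction of the blocks. -/
theorem altSum_levelCell (n : ℕ) (i c : ℤ) (f : Cell → ℤ) :
    (altSum n fun a => altSum n fun b => f ![a, b, c]) =
      altSum n fun a => altSum n fun b => f (levelCell i a b c) := by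
  by_cases h : i % 2 = 0
  · simp only [levelCell_of_even h]
  · simp only [levelCell_of_odd h]
    rw [altSum_comm]

theorem isBoundary_levelCell_iff {K : Set (Fin 3 → ℤ)} {i a b z : ℤ} :
    IsBoundary K (levelCell i a b z) ↔
      (∃ u v w, (((a - 1) / 2 ≤ u ∧ u ≤ a / 2) ∧ ((b - 1) / 2 ≤ v ∧ v ≤ b / 2) ∧
        ((z - 1) / 2 ≤ w ∧ w ≤ z / 2)) ∧ levelCell i u v w ∈ K) ∧
      ¬ ∀ u v w, (((a - 1) / 2 ≤ u ∧ u ≤ a / 2) ∧ ((b - 1) / 2 ≤ v ∧ v ≤ b / 2) ∧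
        ((z - 1) / 2 ≤ w ∧ w ≤ z / 2)) → levelCell i u v w ∈ K := by
  simp only [← over_levelCell_iff (i := i)]
  refine and_congr ⟨?_, ?_⟩ ⟨?_, ?_⟩
  · rintro ⟨t, ht, hover⟩
    obtain ⟨u, v, huv⟩ := exists_eq_levelCell i t
    rw [huv] at ht hover
    exact ⟨u, v, _, hover, ht⟩
  · rintro ⟨u, v, w, hover, ht⟩
    exact ⟨_, ht, hover⟩
  · rintro ⟨t, ht, hover⟩ hall
    obtain ⟨u, v, huv⟩ := exists_eq_levelCell i t
    rw [huv] at ht hover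
    exact ht (hall u v _ hover)
  · intro h
    push Not at h
    obtain ⟨u, v, w, hover, ht⟩ := h
    exact ⟨_, ht, hover⟩

section Stack

variable {n : ℕ} {L : ℤ → ℤ → Prop}

theorem isBoundary_levelCell_odd {i a b : ℤ} :
    IsBoundary (stackCubes n L) (levelCell i a b (2 * i + 1)) ↔
      (Touches (fun u => 0 ≤ u ∧ u < (n : ℤ)) a ∧ Touches (L i) b) ∧
      ¬ (Inside (fun u => 0 ≤ u ∧ u < (n : ℤ)) a ∧ Inside (L i) b) := by
  rw [isBoundary_levelCell_iff]
  have hw : ∀ w, ((2 * i + 1 - 1) / 2 ≤ w ∧ w ≤ (2 * i + 1) / 2) ↔ w = i := by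
    intro w
    omega
  simp only [hw]
  refine and_congr ⟨?_, ?_⟩ (not_congr ⟨?_, ?_⟩)
  · rintro ⟨u, v, w, ⟨hu, hv, rfl⟩, h⟩
    rw [levelCell_mem_iff] at h
    exact ⟨⟨u, hu, h.1⟩, v, hv, h.2⟩
  · rintro ⟨⟨u, hu, h⟩, v, hv, h'⟩
    exact ⟨u, v, i, ⟨hu, hv, rfl⟩, levelCell_mem_iff.2 ⟨h, h'⟩⟩
  · intro h
    exact ⟨fun u hu => (levelCell_mem_iff.1 (h u (b / 2) i ⟨hu, by omega, rfl⟩)).1,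
      fun v hv => (levelCell_mem_iff.1 (h (a / 2) v i ⟨by omega, hv, rfl⟩)).2⟩
  · rintro ⟨h, h'⟩ u v w ⟨hu, hv, rfl⟩
    exact levelCell_mem_iff.2 ⟨h u hu, h' v hv⟩

theorem isBoundary_levelCell_even {i a b : ℤ} :
    IsBoundary (stackCubes n L) (levelCell i a b (2 * (i + 1))) ↔
      ((Touches (fun u => 0 ≤ u ∧ u < (n : ℤ)) a ∧ Touches (L i) b) ∨
        (Touches (L (i + 1)) a ∧ Touches (fun u => 0 ≤ u ∧ u < (n : ℤ)) b)) ∧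
      ¬ ((Inside (fun u => 0 ≤ u ∧ u < (n : ℤ)) a ∧ Inside (L i) b) ∧
        (Inside (L (i + 1)) a ∧ Inside (fun u => 0 ≤ u ∧ u < (n : ℤ)) b)) := by
  rw [isBoundary_levelCell_iff]
  have hw : ∀ w, ((2 * (i + 1) - 1) / 2 ≤ w ∧ w ≤ 2 * (i + 1) / 2) ↔ (w = i ∨ w = i + 1) := by
    intro w
    omega
  have hup : ∀ u v, levelCell i u v (i + 1) ∈ stackCubes n L ↔
      (0 ≤ v ∧ v < n) ∧ L (i + 1) u := by
    intro u v
    rw [← levelCell_add_one i v u, levelCell_mem_iff]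
  simp only [hw]
  refine and_congr ⟨?_, ?_⟩ (not_congr ⟨?_, ?_⟩)
  · rintro ⟨u, v, w, ⟨hu, hv, rfl | rfl⟩, h⟩
    · rw [levelCell_mem_iff] at h
      exact Or.inl ⟨⟨u, hu, h.1⟩, v, hv, h.2⟩
    · rw [hup] at h
      exact Or.inr ⟨⟨u, hu, h.2⟩, v, hv, h.1⟩
  · rintro (⟨⟨u, hu, h⟩, v, hv, h'⟩ | ⟨⟨u, hu, h⟩, v, hv, h'⟩)
    · exact ⟨u, v, i, ⟨hu, hv, Or.inl rfl⟩, levelCell_mem_iff.2 ⟨h, h'⟩⟩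
    · exact ⟨u, v, i + 1, ⟨hu, hv, Or.inr rfl⟩, (hup _ _).2 ⟨h', h⟩⟩
  · intro h
    exact ⟨⟨fun u hu => (levelCell_mem_iff.1 (h u (b / 2) i ⟨hu, by omega, Or.inl rfl⟩)).1,
      fun v hv => (levelCell_mem_iff.1 (h (a / 2) v i ⟨by omega, hv, Or.inl rfl⟩)).2⟩,
      fun u hu => ((hup _ _).1 (h u (b / 2) (i + 1) ⟨hu, by omega, Or.inr rfl⟩)).2,
      fun v hv => ((hup _ _).1 (h (a / 2) v (i + 1) ⟨by omega, hv, Or.inr rfl⟩)).1⟩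
  · rintro ⟨⟨h1, h2⟩, h3, h4⟩ u v w ⟨hu, hv, rfl | rfl⟩
    · exact levelCell_mem_iff.2 ⟨h1 u hu, h2 v hv⟩
    · exact (hup _ _).2 ⟨h4 v hv, h3 u hu⟩

/-- At mid-height the solid is a product of the full segment with `L i`. With `r` runs, the closed
part counts `1 * r` and the interior `(-1) * (-r)`, and these cancel. -/
theorem altSum_layer (hn : 0 < n) (hL : ∀ i j, L i j → 0 ≤ j ∧ j < n) (i : ℤ) :
    (altSum n fun a => altSum n fun b =>
      ind (IsBoundary (stackCubes n L) ![a, b, 2 * i + 1])) = 0 := by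
  rw [altSum_levelCell n i (2 * i + 1) fun z => ind (IsBoundary (stackCubes n L) z)]
  have hI : runs n (fun u => 0 ≤ u ∧ u < (n : ℤ)) = 1 :=
    runs_interval le_rfl (by omega) le_rfl fun _ => Iff.rfl
  have hind : ∀ a b, ind (IsBoundary (stackCubes n L) (levelCell i a b (2 * i + 1))) =
      ind (Touches (fun u => 0 ≤ u ∧ u < (n : ℤ)) a) * ind (Touches (L i) b) -
      ind (Inside (fun u => 0 ≤ u ∧ u < (n : ℤ)) a) * ind (Inside (L i) b) := by
    intro a b
    rw [ind_congr isBoundary_levelCell_odd,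
      ind_and_not fun h => ⟨h.1.touches, h.2.touches⟩, ind_and, ind_and]
  simp only [hind, altSum_sub, altSum_mul]
  rw [altSum_touches fun _ h => h, altSum_touches (hL i), altSum_inside, altSum_inside, hI]
  ring

/-- A cell of the interface is on the boundary if it touches one of the two levels without being
inside both. Inclusion–exclusion over the two crossing families of strips gives `r + r' - r * r'`
for touching; being inside both counts `(-r) * (-r')`. -/
theorem altSum_interface (hn : 0 < n) (hL : ∀ i j, L i j → 0 ≤ j ∧ j < n) (i : ℤ) :
    (altSum n fun a => altSum n fun b =>
      ind (IsBoundary (stackCubes n L) ![a, b, 2 * (i + 1)])) =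
      runs n (L i) + runs n (L (i + 1)) - 2 * (runs n (L i) * runs n (L (i + 1))) := by
  rw [altSum_levelCell n i (2 * (i + 1)) fun z => ind (IsBoundary (stackCubes n L) z)]
  have hI : runs n (fun u => 0 ≤ u ∧ u < (n : ℤ)) = 1 :=
    runs_interval le_rfl (by omega) le_rfl fun _ => Iff.rfl
  have hT : ∀ i a, Touches (L i) a → Touches (fun u => 0 ≤ u ∧ u < (n : ℤ)) a :=
    fun i a ⟨u, hu, h⟩ => ⟨u, hu, hL i u h⟩
  have hIn : ∀ i a, Inside (L i) a → Inside (fun u => 0 ≤ u ∧ u < (n : ℤ)) a :=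
    fun i a h u hu => hL i u (h u hu)
  have hind : ∀ a b, ind (IsBoundary (stackCubes n L) (levelCell i a b (2 * (i + 1)))) =
      ind (Touches (fun u => 0 ≤ u ∧ u < (n : ℤ)) a) * ind (Touches (L i) b) +
      ind (Touches (L (i + 1)) a) * ind (Touches (fun u => 0 ≤ u ∧ u < (n : ℤ)) b) -
      ind (Touches (L (i + 1)) a) * ind (Touches (L i) b) -
      ind (Inside (L (i + 1)) a) * ind (Inside (L i) b) := by
    intro a b
    rw [ind_congr isBoundary_levelCell_even,
      ind_and_not fun h => Or.inl ⟨h.1.1.touches, h.1.2.touches⟩, ind_or, ind_and, ind_and]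
    congr 1
    · congr 1
      -- Touching both levels amounts to touching `L (i + 1)` in one direction and `L i` in the
      -- other; the conditions on the full segment follow.
      rw [← ind_and]
      refine ind_congr ⟨fun h => ⟨h.2.1, h.1.2⟩, fun h => ⟨⟨hT _ _ h.1, h.2⟩, h.1, hT _ _ h.2⟩⟩
    · rw [← ind_and]
      refine ind_congr ⟨fun h => ⟨h.2.1, h.1.2⟩, fun h => ⟨⟨hIn _ _ h.1, h.2⟩, h.1, hIn _ _ h.2⟩⟩
  simp only [hind, altSum_sub, altSum_add, altSum_mul]
  rw [altSum_touches fun _ h => h, altSum_touches (hL i), altSum_touches (hL (i + 1)),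
    altSum_inside, altSum_inside, hI]
  ring

/-- The Euler characteristic of the boundary of a stack of blocks. -/
theorem eulerChar_stack {c : Space} (hc : ∀ d, 0 < c d) (hn : 0 < n) {X : ℕ}
    (hL : ∀ i j, L i j → (0 ≤ i ∧ i < X) ∧ 0 ≤ j ∧ j < n) (hK : (stackCubes n L).Finite) :
    (boundaryPolyhedron c hc (stackCubes n L) hK).eulerChar =
      ∑ j ∈ Finset.range (X + 1), (runs n (L (j - 1)) + runs n (L j) -
        2 * (runs n (L (j - 1)) * runs n (L j))) := by
  have hL' : ∀ i j, L i j → 0 ≤ j ∧ j < n := fun i j h => (hL i j h).2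
  rw [eulerChar_boundaryPolyhedron, eulerChar_eq_altSum (n := n) (X := X), altSum_eq]
  -- Odd heights cancel; height `2 * j` is the interface between levels `j - 1` and `j`, including
  -- the empty levels `-1` and `X`.
  · rw [Finset.sum_eq_zero (s := Finset.range X) fun j _ => altSum_layer hn hL' j, sub_zero]
    refine Finset.sum_congr rfl fun j _ => ?_
    have := altSum_interface hn hL' (j - 1)
    rwa [sub_add_cancel] at this
  · intro b hb
    by_cases h : b 2 % 2 = 0
    · rw [mem_stackCubes_of_even h] at hb
      exact ⟨hb.1, (hL _ _ hb.2).2, (hL _ _ hb.2).1⟩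
    · rw [mem_stackCubes_of_odd h] at hb
      exact ⟨(hL _ _ hb.2).2, hb.1, (hL _ _ hb.2).1⟩

end Stack

/-! ### Configurations of blocks -/

/-- The mesh of the grid in which all blocks have integral corners. -/
def mesh (h : ℝ) : Space := ![1, 1, h]

theorem mesh_pos {h : ℝ} (hh : 0 < h) (d : Fin 3) : 0 < mesh h d := by
  fin_cases d <;> simp [mesh, hh]

/-- Box `j` of level `i` of the configuration `C` holds a block. -/
def Occupied {n x : ℕ} (C : Configuration n x) (i j : ℤ) : Prop :=
  ∃ (i' : Fin x) (j' : Fin n), (i' : ℤ) = i ∧ (j' : ℤ) = j ∧ j' ∈ C i'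

theorem Occupied.bounds {n x : ℕ} {C : Configuration n x} (i j : ℤ) (h : Occupied C i j) :
    (0 ≤ i ∧ i < (x : ℕ)) ∧ 0 ≤ j ∧ j < n := by
  obtain ⟨i', j', rfl, rfl, -⟩ := h
  omega

theorem occupied_iff {n x : ℕ} {C : Configuration n x} {i : Fin x} {j : Fin n} :
    Occupied C i j ↔ j ∈ C i := by
  constructor
  · rintro ⟨i', j', hi, hj, h⟩
    rwa [← Fin.ext (Int.ofNat_inj.1 hi), ← Fin.ext (Int.ofNat_inj.1 hj)]
  · exact fun h => ⟨i, j, rfl, rfl, h⟩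

theorem mem_cellSet_cube {h : ℝ} {b : Fin 3 → ℤ} {p : Space} : p ∈ cellSet (mesh h) (cube b) ↔
    p 0 ∈ Set.Icc (b 0 : ℝ) (b 0 + 1) ∧ p 1 ∈ Set.Icc (b 1 : ℝ) (b 1 + 1) ∧
      p 2 ∈ Set.Icc (h * b 2) (h * (b 2 + 1)) := by
  have h1 : ∀ d, (2 * b d + 1) / 2 = b d := fun d => by omega
  have h2 : ∀ d, (2 * b d + 1 + 1) / 2 = b d + 1 := fun d => by omega
  rw [cellSet, Set.mem_univ_pi, Fin.forall_fin_succ, Fin.forall_fin_two]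
  simp [cube, h1, h2, mesh]

theorem exists_unit_interval {n : ℕ} {t : ℝ} (hn : 0 < n) (ht : t ∈ Set.Icc (0 : ℝ) n) :
    ∃ u : ℤ, (0 ≤ u ∧ u < n) ∧ t ∈ Set.Icc (u : ℝ) (u + 1) := by
  by_cases h : t = n
  -- At `t = n` the floor would leave the range.
  · refine ⟨n - 1, by omega, ?_⟩
    rw [h]
    push_cast
    constructor <;> linarith
  · refine ⟨⌊t⌋, ⟨Int.floor_nonneg.2 ht.1, Int.floor_lt.2 ?_⟩, Int.floor_le t,
      (Int.lt_floor_add_one t).le⟩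
    exact_mod_cast lt_of_le_of_ne ht.2 h

theorem unit_interval_subset {n : ℕ} {t : ℝ} {u : ℤ} (hu : 0 ≤ u ∧ u < n)
    (ht : t ∈ Set.Icc (u : ℝ) (u + 1)) : t ∈ Set.Icc (0 : ℝ) n := by
  have h0 : (0 : ℝ) ≤ u := by exact_mod_cast hu.1
  have h1 : (u : ℝ) + 1 ≤ n := by exact_mod_cast hu.2
  exact ⟨h0.trans ht.1, ht.2.trans h1⟩

theorem solid_eq {n x : ℕ} (hn : 0 < n) (h : ℝ) (C : Configuration n x) :
    solid h C = ⋃ b ∈ stackCubes n (Occupied C), cellSet (mesh h) (cube b) := by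
  ext p
  simp only [solid, Set.mem_iUnion, exists_prop, mem_cellSet_cube]
  constructor
  · rintro ⟨i, j, hj, hp⟩
    by_cases hi : Even (i : ℕ)
    · rw [block, if_pos hi] at hp
      obtain ⟨h0, h1, h2⟩ := hp
      obtain ⟨u, hu, hpu⟩ := exists_unit_interval hn h0
      refine ⟨![u, j, i], ?_, hpu, by simpa using h1, by simpa using h2⟩
      rw [mem_stackCubes_of_even]
      · exact ⟨hu, occupied_iff.2 hj⟩
      · have := Nat.even_iff.1 hi
        simp only [Matrix.cons_val]
        omega
    · rw [block, if_neg hi] at hp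
      obtain ⟨h0, h1, h2⟩ := hp
      obtain ⟨u, hu, hpu⟩ := exists_unit_interval hn h1
      refine ⟨![j, u, i], ?_, by simpa using h0, hpu, by simpa using h2⟩
      rw [mem_stackCubes_of_odd]
      · exact ⟨hu, occupied_iff.2 hj⟩
      · have := Nat.odd_iff.1 (Nat.not_even_iff_odd.1 hi)
        simp only [Matrix.cons_val]
        omega
  · rintro ⟨b, hb, h0, h1, h2⟩
    by_cases hb2 : b 2 % 2 = 0
    · rw [mem_stackCubes_of_even hb2] at hb
      obtain ⟨hu, i, j, hi, hj, hij⟩ := hb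
      refine ⟨i, j, hij, ?_⟩
      rw [block, if_pos (Nat.even_iff.2 (by omega))]
      rw [← hi] at h2
      rw [← hj] at h1
      exact ⟨unit_interval_subset hu h0, by simpa using h1, by simpa using h2⟩
    · rw [mem_stackCubes_of_odd hb2] at hb
      obtain ⟨hu, i, j, hi, hj, hij⟩ := hb
      refine ⟨i, j, hij, ?_⟩
      rw [block, if_neg (by rw [Nat.even_iff]; omega)]
      rw [← hi] at h2
      rw [← hj] at h0
      exact ⟨by simpa using h0, unit_interval_subset hu h1, by simpa using h2⟩

theorem sum_ind_occupied {n x : ℕ} (C : Configuration n x) (i : Fin x) :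
    ∑ j ∈ Finset.range n, ind (Occupied C i j) = (C i).card := by
  rw [Finset.sum_range fun j : ℕ => ind (Occupied C i j)]
  simp only [occupied_iff, ind]
  simp

theorem sum_ind_even (q : ℕ) : ∑ j ∈ Finset.range (2 * q + 1), ind (Even j) = q + 1 := by
  induction q with
  | zero => simp [ind]
  | succ q ih =>
    rw [show 2 * (q + 1) + 1 = 2 * q + 1 + 1 + 1 by ring, Finset.sum_range_succ,
      Finset.sum_range_succ, ih, ind_false (by rw [Nat.even_iff]; omega),
      ind_true (by rw [Nat.even_iff]; omega)]
    push_cast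
    ring

/-! ### Existence and uniqueness of the level data; existence of a configuration. -/

theorem existsUnique_levelData {q k : ℕ} (hk : 2 ≤ k) :
    ∃! p : ℕ × ℕ, LevelData (2 * q + 1) k p.1 p.2 := by
  have e1 : (2 * q + 1 - 1) / 2 = q := by omega
  have e2 : (2 * q + 1 + 1) / 2 = q + 1 := by omega
  -- The equation is division with remainder of `N` by `q + 1`, with quotient `x - 3` and remainder
  -- `l - 1`; `2 ≤ k` makes `N` a natural number.
  obtain ⟨N, hN⟩ : ∃ N, (2 * q + 1) * k = (2 * q + 1) + q + 1 + N := by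
    have : (2 * q + 1) * 2 ≤ (2 * q + 1) * k := Nat.mul_le_mul_left _ hk
    exact ⟨(2 * q + 1) * k - ((2 * q + 1) + q + 1), by omega⟩
  have key : ∀ x l, LevelData (2 * q + 1) k x l ↔
      3 ≤ x ∧ N = (q + 1) * (x - 3) + (l - 1) ∧ 1 ≤ l ∧ l ≤ q + 1 := by
    intro x l
    rw [LevelData, e1, e2, hN]
    omega
  have hdiv := Nat.div_add_mod N (q + 1)
  have hmod := Nat.mod_lt N (show q + 1 > 0 by omega)
  refine ⟨(N / (q + 1) + 3, N % (q + 1) + 1), ?_, ?_⟩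
  · simp only [key]
    refine ⟨Nat.le_add_left 3 _, ?_, Nat.le_add_left 1 _, hmod⟩
    rw [Nat.add_sub_cancel, Nat.add_sub_cancel, hdiv]
  · rintro ⟨x, l⟩ h
    obtain ⟨hx, h, hl, hl'⟩ := (key x l).1 h
    have h1 : N / (q + 1) = x - 3 := by
      rw [h, Nat.mul_add_div (Nat.succ_pos q), Nat.div_eq_of_lt (by omega), add_zero]
    have h2 : N % (q + 1) = l - 1 := by
      rw [h, Nat.mul_add_mod, Nat.mod_eq_of_lt (by omega)]
    rw [Prod.mk.injEq]
    omega

theorem exists_isOddConfiguration {q k x l : ℕ} (h : LevelData (2 * q + 1) k x l) :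
    ∃ C : Configuration (2 * q + 1) x, IsOddConfiguration (2 * q + 1) k x l C := by
  have e1 : (2 * q + 1 - 1) / 2 = q := by omega
  obtain ⟨hx, -, hl, hl'⟩ := id h
  -- The bottom blocks go into boxes `0, 2, …, 2 * (l - 1)`, which fit because `l ≤ q + 1`.
  have hinj : Function.Injective fun t : Fin l => (⟨2 * t, by omega⟩ : Fin (2 * q + 1)) := by
    intro s t hst
    have := Fin.val_eq_of_eq hst
    simp only at this
    exact Fin.ext (by omega)
  refine ⟨fun i => if (i : ℕ) + 1 = x then Finset.univ.filter fun j => (j : ℕ) < q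
    else if (i : ℕ) + 2 = x then Finset.univ
    else if (i : ℕ) = 0 then Finset.univ.image fun t : Fin l => ⟨2 * t, by omega⟩
    else Finset.univ.filter fun j => Even (j : ℕ), h, ?_, ?_, ?_, ?_⟩
  · intro i hi
    refine ⟨0, by omega, fun j => ?_⟩
    rw [if_pos hi, e1]
    simp
  · intro i hi
    rw [if_neg (by omega), if_pos hi]
  · intro i hi hi' j
    rw [if_neg (by omega), if_neg (by omega), if_neg (by omega)]
    simp
  · intro i hi
    rw [if_neg (by omega), if_neg (by omega), if_pos hi]
    refine ⟨by rw [Finset.card_image_of_injective _ hinj]; simp, ?_⟩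
    intro j hj j' hj'
    simp only [Finset.mem_image, Finset.mem_univ, true_and] at hj hj'
    obtain ⟨s, rfl⟩ := hj
    obtain ⟨t, rfl⟩ := hj'
    simp only
    omega

/-! ### The runs of each level and the resulting Euler characteristic. -/

section OddConfiguration

variable {q k x l : ℕ} {C : Configuration (2 * q + 1) x}

theorem IsOddConfiguration.runs_top (hC : IsOddConfiguration (2 * q + 1) k x l C) (hq : 0 < q)
    (i : Fin x) (hi : (i : ℕ) + 1 = x) : runs (2 * q + 1) (Occupied C i) = 1 := by
  obtain ⟨a, ha, hj⟩ := hC.top i hi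
  have e1 : (2 * q + 1 - 1) / 2 = q := by omega
  rw [e1] at ha hj
  refine runs_interval (a := a) (b := a + q) (by omega) (by omega) (by omega) fun j => ?_
  constructor
  · intro h
    obtain ⟨-, h0, h1⟩ := Occupied.bounds _ _ h
    lift j to ℕ using h0
    have := (hj ⟨j, by omega⟩).1 (occupied_iff.1 h)
    simp only at this
    omega
  · intro h
    lift j to ℕ using by omega
    exact (occupied_iff (j := ⟨j, by omega⟩)).2 ((hj _).2 (by simp only; omega))

theorem IsOddConfiguration.runs_second (hC : IsOddConfiguration (2 * q + 1) k x l C)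
    (i : Fin x) (hi : (i : ℕ) + 2 = x) : runs (2 * q + 1) (Occupied C i) = 1 := by
  refine runs_interval (a := 0) (b := (2 * q + 1 : ℕ)) le_rfl (by omega) le_rfl fun j => ?_
  refine ⟨fun h => (Occupied.bounds _ _ h).2, fun h => ?_⟩
  lift j to ℕ using h.1
  refine (occupied_iff (j := ⟨j, by omega⟩)).2 ?_
  rw [hC.second i hi]
  exact Finset.mem_univ _

theorem IsOddConfiguration.runs_middle (hC : IsOddConfiguration (2 * q + 1) k x l C)
    (i : Fin x) (hi : 1 ≤ (i : ℕ)) (hi' : (i : ℕ) + 3 ≤ x) :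
    runs (2 * q + 1) (Occupied C i) = q + 1 := by
  have hiff : ∀ j : ℕ, j < 2 * q + 1 → (Occupied C i j ↔ Even j) := fun j hj =>
    (occupied_iff (j := ⟨j, hj⟩)).trans (hC.middle i hi hi' _)
  rw [runs_of_separated, ← sum_ind_even q]
  · exact Finset.sum_congr rfl fun j hj => ind_congr (hiff j (Finset.mem_range.1 hj))
  · intro j h h'
    obtain ⟨-, h0, h1⟩ := Occupied.bounds _ _ h'
    obtain ⟨-, -, h2⟩ := Occupied.bounds _ _ h
    lift j to ℕ using by omega
    have e : ((j : ℤ) - 1) = ((j - 1 : ℕ) : ℤ) := by omega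
    rw [e, hiff _ (by omega), Nat.even_iff] at h'
    rw [hiff _ (by omega), Nat.even_iff] at h
    omega

theorem IsOddConfiguration.runs_bottom (hC : IsOddConfiguration (2 * q + 1) k x l C)
    (i : Fin x) (hi : (i : ℕ) = 0) : runs (2 * q + 1) (Occupied C i) = l := by
  obtain ⟨hcard, hsep⟩ := hC.bottom i hi
  rw [runs_of_separated, sum_ind_occupied, hcard]
  rintro j ⟨i₁, j₁, h₁, hj₁, hm₁⟩ ⟨i₂, j₂, h₂, hj₂, hm₂⟩
  obtain rfl : i₁ = i := Fin.ext (Int.ofNat_inj.1 h₁)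
  obtain rfl : i₂ = i₁ := Fin.ext (Int.ofNat_inj.1 h₂)
  exact hsep _ hm₂ _ hm₁ (by omega)

/-- An empty level has no runs, whereas the number of runs of every level is known and positive. -/
theorem IsOddConfiguration.exists_occupied (hC : IsOddConfiguration (2 * q + 1) k x l C)
    (hq : 0 < q) (i : ℤ) (h0 : 0 ≤ i) (hx : i < (x : ℕ)) : ∃ j, Occupied C i j := by
  by_contra hno
  push Not at hno
  have h := runs_empty (n := 2 * q + 1) hno
  obtain ⟨hx3, -, hl, -⟩ := hC.levelData
  lift i to ℕ using h0
  obtain ⟨i, rfl⟩ : ∃ i' : Fin x, (i' : ℕ) = i := ⟨⟨i, by omega⟩, rfl⟩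
  by_cases h1 : (i : ℕ) + 1 = x
  · rw [hC.runs_top hq i h1] at h
    omega
  by_cases h2 : (i : ℕ) + 2 = x
  · rw [hC.runs_second i h2] at h
    omega
  by_cases h3 : (i : ℕ) = 0
  · rw [hC.runs_bottom i h3] at h
    omega
  · rw [hC.runs_middle i (by omega) (by omega)] at h
    omega

/-- The contributions are those of the underside of the bottom level, of the interface from the
bottom to the first middle level, and of the `t` interfaces between equal middle levels. -/
theorem sum_runs_init {r : ℤ → ℤ} {a m : ℤ} {t : ℕ} (h0 : r (-1) = 0) (h1 : r 0 = a)
    (hm : ∀ i : ℕ, 1 ≤ i → i ≤ t + 1 → r i = m) :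
    ∑ j ∈ Finset.range (t + 2), (r (j - 1) + r j - 2 * (r (j - 1) * r j)) =
      a + (a + m - 2 * (a * m)) + t * (2 * m - 2 * (m * m)) := by
  induction t with
  | zero =>
    have := hm 1 le_rfl le_rfl
    rw [Finset.sum_range_succ, Finset.sum_range_one]
    simp_all
  | succ t ih =>
    have e1 := hm (t + 1) (by omega) (by omega)
    have e2 := hm (t + 2) (by omega) (by omega)
    rw [Finset.sum_range_succ, ih fun i h h' => hm i h (by omega)]
    have e3 : (((t + 2 : ℕ) : ℤ) - 1) = ((t + 1 : ℕ) : ℤ) := by push_cast; ring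
    rw [e3, e1, e2]
    push_cast
    ring

theorem IsOddConfiguration.sum_runs {k' : ℕ}
    (hC : IsOddConfiguration (2 * q + 1) (k' + 2) x l C) (hq : 0 < q) :
    ∑ j ∈ Finset.range (x + 1), (runs (2 * q + 1) (Occupied C (j - 1)) +
      runs (2 * q + 1) (Occupied C j) -
      2 * (runs (2 * q + 1) (Occupied C (j - 1)) * runs (2 * q + 1) (Occupied C j))) =
      2 - 2 * (((2 * q + 1) * q * k' : ℕ) : ℤ) := by
  obtain ⟨hx3, hk, hl, hl'⟩ := hC.levelData
  rw [show (2 * q + 1 - 1) / 2 = q by omega, show (2 * q + 1 + 1) / 2 = q + 1 by omega] at hk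
  rw [show (2 * q + 1 + 1) / 2 = q + 1 by omega] at hl'
  obtain ⟨y, rfl⟩ : ∃ y, x = y + 3 := ⟨x - 3, by omega⟩
  rw [Nat.add_sub_cancel] at hk
  set r : ℤ → ℤ := fun i => runs (2 * q + 1) (Occupied C i) with hr
  have hneg : r (-1) = 0 := runs_empty fun j h => by
    have := Occupied.bounds _ _ h
    omega
  have hbot : r 0 = l := hC.runs_bottom ⟨0, by omega⟩ rfl
  have hmid : ∀ i : ℕ, 1 ≤ i → i ≤ y → r i = q + 1 := fun i h h' =>
    hC.runs_middle ⟨i, by omega⟩ h (by simp only; omega)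
  have h1 : r ((y + 1 : ℕ) : ℤ) = 1 := hC.runs_second ⟨y + 1, by omega⟩ rfl
  have h2 : r ((y + 2 : ℕ) : ℤ) = 1 := hC.runs_top hq ⟨y + 2, by omega⟩ rfl
  have h3 : r ((y + 3 : ℕ) : ℤ) = 0 := runs_empty fun j h => by
    have := Occupied.bounds _ _ h
    omega
  change ∑ j ∈ Finset.range (y + 3 + 1), (r (j - 1) + r j - 2 * (r (j - 1) * r j)) = _
  rw [Finset.sum_range_succ, Finset.sum_range_succ, Finset.sum_range_succ]
  have e1 : (((y + 1 : ℕ) : ℤ) - 1) = (y : ℤ) := by push_cast; ring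
  have e2 : (((y + 2 : ℕ) : ℤ) - 1) = ((y + 1 : ℕ) : ℤ) := by push_cast; ring
  have e3 : (((y + 3 : ℕ) : ℤ) - 1) = ((y + 2 : ℕ) : ℤ) := by push_cast; ring
  rw [e1, e2, e3, h1, h2, h3]
  -- Without middle levels the block count `n + q + l` is at most `2 * n`, which forces `k = 2` and
  -- genus zero.
  rcases y with _ | t
  · have hk0 : k' = 0 := by
      by_contra hk0
      have : (2 * q + 1) * 1 ≤ (2 * q + 1) * k' := Nat.mul_le_mul_left _ (by omega)
      rw [mul_add] at hk
      omega
    rw [zero_add, Finset.sum_range_one, hk0]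
    simp [hneg, hbot]
    ring
  · rw [sum_runs_init hneg hbot hmid, hmid (t + 1) (by omega) le_rfl]
    have hk' : ((2 * q + 1) * (k' + 2) : ℤ) = (2 * q + 1) + q + (q + 1) * (t + 1) + l := by
      exact_mod_cast hk
    push_cast
    -- The genus comes out as `q * (l + (q + 1) * t)`, and the block count identifies the bracket
    -- with `(2 * q + 1) * k'`.
    linear_combination (2 * q : ℤ) * hk'

end OddConfiguration

end Jenga

theorem mainTheorem1 (n k : ℕ) (hn : Odd n) (hn1 : 1 < n) (hk : 2 ≤ k) :
    (∃! p : ℕ × ℕ, Jenga.LevelData n k p.1 p.2) ∧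
    (∃ (x l : ℕ) (C : Jenga.Configuration n x), Jenga.IsOddConfiguration n k x l C) ∧
    ∀ (x l : ℕ) (C : Jenga.Configuration n x), Jenga.IsOddConfiguration n k x l C →
      ∀ h : ℝ, 0 < h →
        ∃ g : ℕ, (g : ℚ) = (n : ℚ) * ((n : ℚ) - 1) * ((k : ℚ) - 2) / 2 ∧
          Jenga.IsPolyhedralClosedSurfaceOfGenus (Jenga.surface h C) g := by
  obtain ⟨q, rfl⟩ := hn
  obtain ⟨k, rfl⟩ : ∃ k', k = k' + 2 := ⟨k - 2, by omega⟩
  have hq : 0 < q := by omega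
  refine ⟨Jenga.existsUnique_levelData hk, ?_, ?_⟩
  · obtain ⟨⟨x, l⟩, h, -⟩ := Jenga.existsUnique_levelData (q := q) hk
    exact ⟨x, l, Jenga.exists_isOddConfiguration h⟩
  · intro x l C hC h hh
    -- Here `k` stands for the original `k - 2`, so the genus is visibly a natural number.
    refine ⟨(2 * q + 1) * q * k, ?_, ?_⟩
    · push_cast
      ring
    · have hx := hC.levelData.1
      have hK := Jenga.finite_stackCubes (Jenga.Occupied.bounds (C := C))
      refine ⟨Jenga.boundaryPolyhedron _ (Jenga.mesh_pos hh) _ hK, ?_, ?_, ?_, ?_⟩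
      · rw [Jenga.support_boundaryPolyhedron, Jenga.surface, Jenga.solid_eq (by omega)]
      · exact Jenga.isClosedSurface_stack _ (fun i j h => (Jenga.Occupied.bounds i j h).2) hK
      · rw [Jenga.surface, Jenga.solid_eq (by omega)]
        exact Jenga.isConnected_frontier_stack (Jenga.mesh_pos hh) (by omega) (by omega)
          Jenga.Occupied.bounds (hC.exists_occupied hq)
      · rw [Jenga.eulerChar_stack _ (by omega) Jenga.Occupied.bounds]
        exact hC.sum_runs hq
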